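/- Let $n\ge 1$, let $M$ be a finite-dimensional smooth manifold with a closed form $\omega\in\Omega^{n+1}(M)$ (a pre-$n$-plectic manifold), and let $G$ be a Lie group with Lie algebra $\mathfrak g$ acting smoothly on $M$ and preserving $\omega$. For $x\in\mathfrak g$ let $v_x$ be its infinitesimal generator, $v_x(p)=\frac{d}{dt}\big|_{t=0}\exp(-tx)\cdot p$. An $(n-1)$-form $\alpha$ is *Hamiltonian* if $d\alpha=-\iota_{v_\alpha}\omega$ for some vector field $v_\alpha$. Let $L_\infty(M,\omega)$ be the $L_\infty$-algebra whose degree-$0$ part $L_0$ is the space of Hamiltonian $(n-1)$-forms, with $L_i=\Omega^{n-1+i}(M)$ for $-n+1\le i<0$ and $L_i=0$ otherwise; its differential $l_1$ is $d$ in negative degrees and $0$ on $L_0$; and for $k\ge 2$, $l_k(\alpha_1,\dots,\alpha_k)=\varsigma(k)\,\iota(v_{\alpha_1}\wedge\dots\wedge v_{\alpha_k})\omega$ if all $\alpha_i$ have degree $0$, and $l_k=0$ if some argument has negative degree. Here $\varsigma(k)=-(-1)^{k(k+1)/2}$ and $\iota(v_1\wedge\dots\wedge v_k)=\iota_{v_k}\cdots\iota_{v_1}$.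 A *homotopy moment map* is an $L_\infty$-morphism $f\colon\mathfrak g\to L_\infty(M,\omega)$, with components $f_k\colon\wedge^k\mathfrak g\to\Omega^{n-k}(M)$ for $k=1,\dots,n$, such that $d(f_1(x))=-\iota_{v_x}\omega$ for all $x\in\mathfrak g$. *Inner equivalence.* On $\wedge^{\ge 1}\mathfrak g^*\otimes\Omega(M)$ let $d_{tot}$ act on $\wedge^k\mathfrak g^*\otimes\Omega(M)$ as $d_{\mathfrak g}+(-1)^k d$, where $d$ is the de Rham differential and $d_{\mathfrak g}$ is the Chevalley–Eilenberg differential, $(d_{\mathfrak g}\eta)(x_1,\dots,x_{k+1})=\sum_{i<j}(-1)^{i+j}\eta([x_i,x_j],x_1,\dots,\widehat{x_i},\dots,\widehat{x_j},\dots,x_{k+1})$. To homotopy moment maps $f,f'$ associate $\varphi=\sum_k\varsigma(k)f_k$ and $\varphi'=\sum_k\varsigma(k)f'_k$. Then $f$ and $f'$ are inner equivalent if $\varphi'-\varphi=d_{tot}\eta$ for some $\eta\in\bigoplus_{k\ge1}\wedge^k\mathfrak g^*\otimes\Omega^{n-1-k}(M)$. *Equivalence of $L_\infty$-morphisms.*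 Let $\Omega(\mathbb R)=\mathbb R[t]+\mathbb R[t]\,dt$ be the differential graded algebra of polynomial forms on the line. For an $L_\infty$-algebra $L$, the $L_\infty$-algebra $L\otimes\Omega(\mathbb R)$ has differential $l_1(\gamma\otimes\Gamma)=l_1(\gamma)\otimes\Gamma+(-1)^{\deg\gamma}\gamma\otimes d\Gamma$, and for $k\ge2$ its brackets $l_k$ are those of $L$ extended $\Omega(\mathbb R)$-multilinearly (with Koszul signs). Two $L_\infty$-morphisms $f,f'\colon\widetilde L\to L$ are equivalent if there is an $L_\infty$-morphism $H\colon\widetilde L\to L\otimes\Omega(\mathbb R)$ with $H|_{t=0,\,dt=0}=f$ and $H|_{t=1,\,dt=0}=f'$. **Proposition.** Two homotopy moment maps $f,f'$ for the action of $G$ on $(M,\omega)$ are inner equivalent if and only if they are equivalent as $L_\infty$-morphisms $\mathfrak g\to L_\infty(M,\omega)$. -/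

import Mathlib

open scoped Manifold ContDiff Topology
open Set Filter

noncomputable section

namespace MomentMaps

section Forms

variable {E : Type*} [NormedAddCommGroup E] [NormedSpace ℝ E]
variable {M : Type*} [TopologicalSpace M] [ChartedSpace E M]

/-- The local representative of `α` in the chart at `x₀`. -/
def localRep {k : ℕ} (α : ∀ p : M, TangentSpace 𝓘(ℝ, E) p [⋀^Fin k]→L[ℝ] ℝ) (x₀ : M) (y : E) :
    E [⋀^Fin k]→L[ℝ] ℝ :=
  (α ((extChartAt 𝓘(ℝ, E) x₀).symm y)).compContinuousLinearMap
    (mfderiv 𝓘(ℝ, E) 𝓘(ℝ, E) (extChartAt 𝓘(ℝ, E) x₀).symm y)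

variable (E M) in
/-- `Ω^k(M)`: families of alternating `k`-forms on the tangent spaces whose local representatives
are smooth. -/
def Form (k : ℕ) : Submodule ℝ (∀ p : M, TangentSpace 𝓘(ℝ, E) p [⋀^Fin k]→L[ℝ] ℝ) where
  carrier := {α | ∀ x₀ : M, ContDiffOn ℝ ∞ (localRep α x₀) (extChartAt 𝓘(ℝ, E) x₀).target}
  zero_mem' := fun x₀ => by
    have : localRep (0 : ∀ p : M, TangentSpace 𝓘(ℝ, E) p [⋀^Fin k]→L[ℝ] ℝ) x₀ = 0 := rfl
    rw [this]; exact contDiffOn_const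
  add_mem' := fun {a b} ha hb x₀ => by
    have : localRep (a + b) x₀ = localRep a x₀ + localRep b x₀ := rfl
    rw [this]; exact (ha x₀).add (hb x₀)
  smul_mem' := fun c a ha x₀ => by
    have : localRep (c • a) x₀ = c • localRep a x₀ := rfl
    rw [this]; exact (ha x₀).const_smul c

/-- The exterior derivative of a form, computed at `p` in the chart at `p`. It agrees with the
one computed in any other chart, see `localRep_extDerivFun`. -/
def extDerivFun {k : ℕ} (α : ∀ p : M, TangentSpace 𝓘(ℝ, E) p [⋀^Fin k]→L[ℝ] ℝ) (p : M) :
    TangentSpace 𝓘(ℝ, E) p [⋀^Fin (k + 1)]→L[ℝ] ℝ :=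
  (extDeriv (localRep α p) (extChartAt 𝓘(ℝ, E) p p)).compContinuousLinearMap
    (mfderiv 𝓘(ℝ, E) 𝓘(ℝ, E) (extChartAt 𝓘(ℝ, E) p) p)

theorem minSmoothness_two_le : minSmoothness ℝ 2 ≤ (∞ : ℕ∞ω) := by
  rw [minSmoothness_of_isRCLikeNormedField]; exact ENat.LEInfty.out

theorem form_congr {k : ℕ} (α : ∀ p : M, TangentSpace 𝓘(ℝ, E) p [⋀^Fin k]→L[ℝ] ℝ) {p q : M}
    (h : p = q) (v : Fin k → E) : α p v = α q v := by subst h; rfl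

variable [IsManifold 𝓘(ℝ, E) ∞ M]

theorem mdiffAt_symm (x₀ : M) {y : E} (hy : y ∈ (extChartAt 𝓘(ℝ, E) x₀).target) :
    MDifferentiableAt 𝓘(ℝ, E) 𝓘(ℝ, E) (extChartAt 𝓘(ℝ, E) x₀).symm y := by
  have := mdifferentiableWithinAt_extChartAt_symm (I := 𝓘(ℝ, E)) hy
  rwa [modelWithCornersSelf_coe, range_id, mdifferentiableWithinAt_univ] at this

theorem mdiffAt_chart (x₀ : M) {q : M} (hq : q ∈ (extChartAt 𝓘(ℝ, E) x₀).source) :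
    MDifferentiableAt 𝓘(ℝ, E) 𝓘(ℝ, E) (extChartAt 𝓘(ℝ, E) x₀) q :=
  mdifferentiableAt_extChartAt (by simpa using hq)

theorem mfderiv_chart_symm_comp (x₀ : M) {y : E} (hy : y ∈ (extChartAt 𝓘(ℝ, E) x₀).target)
    (v : E) :
    mfderiv 𝓘(ℝ, E) 𝓘(ℝ, E) (extChartAt 𝓘(ℝ, E) x₀) ((extChartAt 𝓘(ℝ, E) x₀).symm y)
      (mfderiv 𝓘(ℝ, E) 𝓘(ℝ, E) (extChartAt 𝓘(ℝ, E) x₀).symm y v) = v := by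
  have := mfderiv_extChartAt_comp_mfderivWithin_extChartAt_symm (I := 𝓘(ℝ, E)) hy
  simp only [modelWithCornersSelf_coe, range_id, mfderivWithin_univ] at this
  exact congrArg (fun L => L v) this

theorem mfderiv_symm_comp_chart (x₀ : M) {q : M} (hq : q ∈ (extChartAt 𝓘(ℝ, E) x₀).source)
    (v : TangentSpace 𝓘(ℝ, E) q) :
    mfderiv 𝓘(ℝ, E) 𝓘(ℝ, E) (extChartAt 𝓘(ℝ, E) x₀).symm (extChartAt 𝓘(ℝ, E) x₀ q)
      (mfderiv 𝓘(ℝ, E) 𝓘(ℝ, E) (extChartAt 𝓘(ℝ, E) x₀) q v) = v := by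
  have := mfderivWithin_extChartAt_symm_comp_mfderiv_extChartAt' (I := 𝓘(ℝ, E)) hq
  simp only [modelWithCornersSelf_coe, range_id, mfderivWithin_univ] at this
  exact congrArg (fun L => L v) this

/-- The coordinate change from the chart at `x₀` to the chart at `p`. -/
def trans (x₀ p : M) : E → E := (extChartAt 𝓘(ℝ, E) p) ∘ (extChartAt 𝓘(ℝ, E) x₀).symm

theorem contDiffAt_trans (x₀ p : M) {y : E} (hy : y ∈ (extChartAt 𝓘(ℝ, E) x₀).target)
    (hp : (extChartAt 𝓘(ℝ, E) x₀).symm y ∈ (extChartAt 𝓘(ℝ, E) p).source) :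
    ContDiffAt ℝ ∞ (trans x₀ p) y := by
  rw [← contMDiffAt_iff_contDiffAt]
  have h1 : ContMDiffAt 𝓘(ℝ, E) 𝓘(ℝ, E) ∞ (extChartAt 𝓘(ℝ, E) x₀).symm y :=
    (contMDiffOn_extChartAt_symm x₀).contMDiffAt ((isOpen_extChartAt_target x₀).mem_nhds hy)
  exact (contMDiffAt_extChartAt' (by simpa using hp)).comp y h1

theorem fderiv_trans (x₀ p : M) {y : E} (hy : y ∈ (extChartAt 𝓘(ℝ, E) x₀).target)
    (hp : (extChartAt 𝓘(ℝ, E) x₀).symm y ∈ (extChartAt 𝓘(ℝ, E) p).source) (v : E) :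
    fderiv ℝ (trans x₀ p) y v =
      mfderiv 𝓘(ℝ, E) 𝓘(ℝ, E) (extChartAt 𝓘(ℝ, E) p) ((extChartAt 𝓘(ℝ, E) x₀).symm y)
        (mfderiv 𝓘(ℝ, E) 𝓘(ℝ, E) (extChartAt 𝓘(ℝ, E) x₀).symm y v) := by
  rw [← mfderiv_eq_fderiv, trans, mfderiv_comp y (mdiffAt_chart p hp) (mdiffAt_symm x₀ hy)]
  rfl

theorem localRep_trans {k : ℕ} (α : ∀ p : M, TangentSpace 𝓘(ℝ, E) p [⋀^Fin k]→L[ℝ] ℝ)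
    (x₀ p : M) {y : E} (hy : y ∈ (extChartAt 𝓘(ℝ, E) x₀).target)
    (hp : (extChartAt 𝓘(ℝ, E) x₀).symm y ∈ (extChartAt 𝓘(ℝ, E) p).source) :
    localRep α x₀ y =
      (localRep α p (trans x₀ p y)).compContinuousLinearMap (fderiv ℝ (trans x₀ p) y) := by
  ext v
  have h : (extChartAt 𝓘(ℝ, E) p).symm (trans x₀ p y) = (extChartAt 𝓘(ℝ, E) x₀).symm y :=
    (extChartAt 𝓘(ℝ, E) p).left_inv hp
  change α _ (fun i => mfderiv 𝓘(ℝ, E) 𝓘(ℝ, E) (extChartAt 𝓘(ℝ, E) x₀).symm y (v i)) =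
    α ((extChartAt 𝓘(ℝ, E) p).symm (trans x₀ p y))
      (fun i => mfderiv 𝓘(ℝ, E) 𝓘(ℝ, E) (extChartAt 𝓘(ℝ, E) p).symm (trans x₀ p y)
        (fderiv ℝ (trans x₀ p) y (v i)))
  refine (form_congr α h.symm _).trans ?_
  congr 1
  funext i
  rw [fderiv_trans x₀ p hy hp]
  exact (mfderiv_symm_comp_chart p hp _).symm

theorem eventually_chart (x₀ p : M) {y : E} (hy : y ∈ (extChartAt 𝓘(ℝ, E) x₀).target)
    (hp : (extChartAt 𝓘(ℝ, E) x₀).symm y ∈ (extChartAt 𝓘(ℝ, E) p).source) :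
    ∀ᶠ z in 𝓝 y, z ∈ (extChartAt 𝓘(ℝ, E) x₀).target ∧
      (extChartAt 𝓘(ℝ, E) x₀).symm z ∈ (extChartAt 𝓘(ℝ, E) p).source :=
  (show ∀ᶠ z in 𝓝 y, z ∈ (extChartAt 𝓘(ℝ, E) x₀).target from
    (isOpen_extChartAt_target x₀).mem_nhds hy).and
    (((continuousOn_extChartAt_symm x₀).continuousAt ((isOpen_extChartAt_target x₀).mem_nhds hy))
      ((isOpen_extChartAt_source p).mem_nhds hp))

theorem contDiffAt_localRep {k : ℕ} (α : Form E M k) (x₀ : M) {y : E}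
    (hy : y ∈ (extChartAt 𝓘(ℝ, E) x₀).target) : ContDiffAt ℝ ∞ (localRep α.1 x₀) y :=
  (α.2 x₀).contDiffAt ((isOpen_extChartAt_target x₀).mem_nhds hy)

theorem localRep_extDerivFun {k : ℕ} (α : Form E M k) (x₀ : M) {y : E}
    (hy : y ∈ (extChartAt 𝓘(ℝ, E) x₀).target) :
    localRep (extDerivFun α.1) x₀ y = extDeriv (localRep α.1 x₀) y := by
  set p := (extChartAt 𝓘(ℝ, E) x₀).symm y with hpdef
  have hp : (extChartAt 𝓘(ℝ, E) x₀).symm y ∈ (extChartAt 𝓘(ℝ, E) p).source :=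
    mem_extChartAt_source p
  have h1 : localRep α.1 x₀ =ᶠ[𝓝 y] fun z =>
      (localRep α.1 p (trans x₀ p z)).compContinuousLinearMap (fderiv ℝ (trans x₀ p) z) :=
    (eventually_chart x₀ p hy hp).mono fun z hz => localRep_trans α.1 x₀ p hz.1 hz.2
  rw [h1.extDeriv_eq, extDeriv_pullback (f := trans x₀ p) (r := ∞)
    (((contDiffAt_localRep α p
      ((extChartAt 𝓘(ℝ, E) p).map_source hp))).differentiableAt (by simp))
    (contDiffAt_trans x₀ p hy hp) minSmoothness_two_le]
  ext v
  change extDeriv (localRep α.1 p) _ (fun i => mfderiv 𝓘(ℝ, E) 𝓘(ℝ, E) (extChartAt 𝓘(ℝ, E) p) p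
      (mfderiv 𝓘(ℝ, E) 𝓘(ℝ, E) (extChartAt 𝓘(ℝ, E) x₀).symm y (v i))) =
    extDeriv (localRep α.1 p) _ (fun i => fderiv ℝ (trans x₀ p) y (v i))
  congr 1
  funext i
  exact (fderiv_trans x₀ p hy hp (v i)).symm

theorem localRep_injective {k : ℕ} {α β : ∀ p : M, TangentSpace 𝓘(ℝ, E) p [⋀^Fin k]→L[ℝ] ℝ} {p : M}
    (h : localRep α p (extChartAt 𝓘(ℝ, E) p p) = localRep β p (extChartAt 𝓘(ℝ, E) p p)) :
    α p = β p := by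
  ext v
  have h2 := congrArg (fun f => f (fun i => mfderiv 𝓘(ℝ, E) 𝓘(ℝ, E) (extChartAt 𝓘(ℝ, E) p) p (v i))) h
  have key (γ : ∀ p : M, TangentSpace 𝓘(ℝ, E) p [⋀^Fin k]→L[ℝ] ℝ) :
      localRep γ p (extChartAt 𝓘(ℝ, E) p p)
        (fun i => mfderiv 𝓘(ℝ, E) 𝓘(ℝ, E) (extChartAt 𝓘(ℝ, E) p) p (v i)) = γ p v := by
    refine (form_congr γ (extChartAt_to_inv (I := 𝓘(ℝ, E)) p) _).trans ?_
    congr 1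
    funext i
    exact mfderiv_symm_comp_chart p (mem_extChartAt_source p) _
  exact (key α).symm.trans (h2.trans (key β))

theorem contDiffAt_extDeriv {k : ℕ} {a : E → E [⋀^Fin k]→L[ℝ] ℝ} {y : E}
    (h : ContDiffAt ℝ ∞ a y) : ContDiffAt ℝ ∞ (extDeriv a) y := by
  have h1 : ContDiffAt ℝ ∞ (fderiv ℝ a) y := h.fderiv_right (m := ∞) (by simp)
  exact h1.continuousLinearMap_comp (ContinuousAlternatingMap.alternatizeUncurryFinCLM ℝ E ℝ)

/-- The exterior derivative. -/
def extD (k : ℕ) : Form E M k →ₗ[ℝ] Form E M (k + 1) where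
  toFun α := ⟨extDerivFun α.1, fun x₀ => by
    intro y hy
    refine (ContDiffAt.congr_of_eventuallyEq (contDiffAt_extDeriv (contDiffAt_localRep α x₀ hy))
      ?_).contDiffWithinAt
    filter_upwards [(isOpen_extChartAt_target (I := 𝓘(ℝ, E)) x₀).mem_nhds hy] with z hz
    exact localRep_extDerivFun α x₀ hz⟩
  map_add' α β := by
    ext p : 2
    have h := mem_extChartAt_target (I := 𝓘(ℝ, E)) p
    have := extDeriv_add ((contDiffAt_localRep α p h).differentiableAt (by simp))
      ((contDiffAt_localRep β p h).differentiableAt (by simp))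
    change ContinuousAlternatingMap.compContinuousLinearMap (extDeriv (localRep α.1 p + localRep β.1 p) _) _ = _
    rw [this]
    rfl
  map_smul' c α := by
    ext p : 2
    change ContinuousAlternatingMap.compContinuousLinearMap (extDeriv (c • localRep α.1 p) _) _ = _
    rw [extDeriv_smul]
    rfl

theorem extD_extD {k : ℕ} (α : Form E M k) : extD (k + 1) (extD k α) = 0 := by
  ext p : 2
  apply localRep_injective
  have h := mem_extChartAt_target (I := 𝓘(ℝ, E)) p
  refine (localRep_extDerivFun (extD k α) p h).trans ?_
  have : localRep (extD k α).1 p =ᶠ[𝓝 (extChartAt 𝓘(ℝ, E) p p)] extDeriv (localRep α.1 p) := by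
    filter_upwards [(isOpen_extChartAt_target (I := 𝓘(ℝ, E)) p).mem_nhds h] with z hz
    exact localRep_extDerivFun α p hz
  rw [this.extDeriv_eq, extDeriv_extDeriv_apply (contDiffAt_localRep α p h) minSmoothness_two_le]
  rfl

variable (E M) in
/-- Smooth vector fields on `M`. -/
abbrev VField := Cₛ^∞⟮𝓘(ℝ, E); E, (TangentSpace 𝓘(ℝ, E) : M → Type _)⟯

/-- The local representative of a vector field in the chart at `x₀`. -/
def vRep (v : VField E M) (x₀ : M) (y : E) : E :=
  mfderiv 𝓘(ℝ, E) 𝓘(ℝ, E) (extChartAt 𝓘(ℝ, E) x₀) ((extChartAt 𝓘(ℝ, E) x₀).symm y)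
    (v ((extChartAt 𝓘(ℝ, E) x₀).symm y))

theorem contDiffOn_vRep (v : VField E M) (x₀ : M) :
    ContDiffOn ℝ ∞ (vRep v x₀) (extChartAt 𝓘(ℝ, E) x₀).target := by
  intro y hy
  set q := (extChartAt 𝓘(ℝ, E) x₀).symm y with hq
  have hqs : q ∈ (extChartAt 𝓘(ℝ, E) x₀).source := (extChartAt 𝓘(ℝ, E) x₀).map_target hy
  let e := trivializationAt E (TangentSpace 𝓘(ℝ, E) : M → Type _) x₀
  have hqe : q ∈ e.baseSet := by
    rw [TangentBundle.trivializationAt_baseSet]; simpa using hqs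
  have h1 : ContMDiffAt 𝓘(ℝ, E) 𝓘(ℝ, E) ∞ (fun p => (e ⟨p, v p⟩).2) q :=
    (e.contMDiffAt_section_iff hqe).1 (v.contMDiff q)
  have h2 : ContMDiffAt 𝓘(ℝ, E) 𝓘(ℝ, E) ∞ (extChartAt 𝓘(ℝ, E) x₀).symm y :=
    (contMDiffOn_extChartAt_symm x₀).contMDiffAt ((isOpen_extChartAt_target x₀).mem_nhds hy)
  have h3 := (contMDiffAt_iff_contDiffAt.1 (h1.comp y h2))
  refine (h3.congr_of_eventuallyEq ?_).contDiffWithinAt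
  filter_upwards [(isOpen_extChartAt_target (I := 𝓘(ℝ, E)) x₀).mem_nhds hy] with z hz
  have hz' := (extChartAt 𝓘(ℝ, E) x₀).map_target hz
  have hz'' : (extChartAt 𝓘(ℝ, E) x₀).symm z ∈ (chartAt E x₀).source := by simpa using hz'
  have := TangentBundle.continuousLinearMapAt_trivializationAt (I := 𝓘(ℝ, E)) hz''
  have h4 := congrArg (fun L => L (v ((extChartAt 𝓘(ℝ, E) x₀).symm z))) this
  refine h4.symm.trans ?_
  have hze : (extChartAt 𝓘(ℝ, E) x₀).symm z ∈ e.baseSet := by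
    rw [TangentBundle.trivializationAt_baseSet]; exact hz''
  exact e.continuousLinearMapAt_apply_of_mem ℝ hze _

end Forms

section Local
variable {E : Type*} [NormedAddCommGroup E] [NormedSpace ℝ E]
open ContinuousAlternatingMap

/-- Insertion of a fixed vector, as a continuous linear map. -/
def insCLM (k : ℕ) (u : E) : (E [⋀^Fin (k + 1)]→L[ℝ] ℝ) →L[ℝ] (E [⋀^Fin k]→L[ℝ] ℝ) :=
  (ContinuousLinearMap.apply ℝ (E [⋀^Fin k]→L[ℝ] ℝ) u).comp
    (curryLeftLI (𝕜 := ℝ) (E := E) (F := ℝ) (n := k)).toContinuousLinearMap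

theorem insCLM_apply (k : ℕ) (u : E) (a : E [⋀^Fin (k + 1)]→L[ℝ] ℝ) :
    insCLM k u a = a.curryLeft u := rfl

theorem curryLeft_alt {k : ℕ} (f : E →L[ℝ] (E [⋀^Fin (k + 1)]→L[ℝ] ℝ)) (v : E) :
    (alternatizeUncurryFin f).curryLeft v =
      f v - alternatizeUncurryFin ((insCLM k v).comp f) := by
  ext w
  rw [curryLeft_apply_apply, alternatizeUncurryFin_apply, Fin.sum_univ_succ]
  rw [ContinuousAlternatingMap.sub_apply, alternatizeUncurryFin_apply, sub_eq_add_neg, ← Finset.sum_neg_distrib]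
  congr 1
  · simp
  · refine Finset.sum_congr rfl fun i _ => ?_
    have : i.succ.removeNth (Matrix.vecCons v w) = Matrix.vecCons v (i.removeNth w) := by
      ext j; refine Fin.cases ?_ (fun j => ?_) j <;> simp [Fin.removeNth, Matrix.vecCons]
    rw [this]
    simp [pow_succ, insCLM_apply]

theorem hasFDerivAt_ins {k : ℕ} {a : E → E [⋀^Fin (k + 1)]→L[ℝ] ℝ} {u : E → E} {y : E}
    (ha : DifferentiableAt ℝ a y) (hu : DifferentiableAt ℝ u y) :
    HasFDerivAt (fun z => (a z).curryLeft (u z))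
      ((insCLM k (u y)).comp (fderiv ℝ a y) + ((a y).curryLeft).comp (fderiv ℝ u y)) y := by
  have h1 : HasFDerivAt (fun z => (a z).curryLeft)
      ((curryLeftLI (𝕜 := ℝ) (E := E) (F := ℝ) (n := k)).toContinuousLinearMap.comp (fderiv ℝ a y)) y := by
    let L := (curryLeftLI (𝕜 := ℝ) (E := E) (F := ℝ) (n := k)).toContinuousLinearMap
    refine HasFDerivAt.comp (g := L) (g' := L) y ?_ ha.hasFDerivAt
    exact L.hasFDerivAt
  have h2 := h1.clm_apply hu.hasFDerivAt
  convert! h2 using 1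
  ext h w
  simp [insCLM_apply, add_comm]

theorem cartan_local {k : ℕ} {a : E → E [⋀^Fin (k + 1)]→L[ℝ] ℝ} {u : E → E} {y : E}
    (ha : DifferentiableAt ℝ a y) (hu : DifferentiableAt ℝ u y) :
    extDeriv (fun z => (a z).curryLeft (u z)) y + (extDeriv a y).curryLeft (u y) =
      fderiv ℝ a y (u y) + alternatizeUncurryFin (((a y).curryLeft).comp (fderiv ℝ u y)) := by
  rw [extDeriv, (hasFDerivAt_ins ha hu).fderiv, alternatizeUncurryFin_add, extDeriv, curryLeft_alt]
  abel

theorem extDeriv_ins_ins {k : ℕ} {a : E → E [⋀^Fin (k + 2)]→L[ℝ] ℝ} {u v : E → E} {y : E}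
    (ha : DifferentiableAt ℝ a y) (hu : DifferentiableAt ℝ u y) (hv : DifferentiableAt ℝ v y)
    (h0 : extDeriv a y = 0) (h1 : extDeriv (fun z => (a z).curryLeft (u z)) y = 0)
    (h2 : extDeriv (fun z => (a z).curryLeft (v z)) y = 0) :
    extDeriv (fun z => ((a z).curryLeft (v z)).curryLeft (u z)) y =
      (a y).curryLeft (VectorField.lieBracket ℝ u v y) := by
  have hb := hasFDerivAt_ins ha hv
  have c1 := cartan_local hb.differentiableAt hu
  rw [h2, hb.fderiv] at c1
  have c2 := cartan_local ha hu
  rw [h0, h1] at c2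
  have c3 := congrArg (fun b => b.curryLeft (v y)) c2
  simp only [curryLeft_add, curryLeft_zero, zero_apply, _root_.add_apply, curryLeft_alt, add_zero] at c1 c3
  have key : alternatizeUncurryFin ((insCLM k (v y)).comp ((a y).curryLeft.comp (fderiv ℝ u y))) =
      - alternatizeUncurryFin (((a y).curryLeft (v y)).curryLeft.comp (fderiv ℝ u y)) := by
    rw [← neg_one_smul ℝ (alternatizeUncurryFin _), ← alternatizeUncurryFin_smul]
    congr 1
    ext h w
    have h3 := (a y).map_swap (Matrix.vecCons (fderiv ℝ u y h) (Matrix.vecCons (v y) w))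
      (i := 0) (j := 1) (by simp)
    have h4 : Matrix.vecCons (fderiv ℝ u y h) (Matrix.vecCons (v y) w) ∘ ⇑(Equiv.swap 0 1) =
        Matrix.vecCons (v y) (Matrix.vecCons (fderiv ℝ u y h) w) := by
      ext j
      refine Fin.cases (by simp) (fun j => ?_) j
      refine Fin.cases (by simp) (fun j => ?_) j
      have : Equiv.swap (0 : Fin (k + 2)) 1 j.succ.succ = j.succ.succ :=
        Equiv.swap_apply_of_ne_of_ne (by simp) (by simp [Fin.ext_iff])
      simp [this]
    rw [h4] at h3
    change a y (Matrix.vecCons (fderiv ℝ u y h) (Matrix.vecCons (v y) w)) =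
      (-1 : ℝ) • a y (Matrix.vecCons (v y) (Matrix.vecCons (fderiv ℝ u y h) w))
    rw [neg_one_smul]
    exact (neg_eq_iff_eq_neg.2 h3).symm
  rw [key] at c3
  rw [c1, VectorField.lieBracket, map_sub]
  simp [insCLM_apply] at c3 ⊢
  rw [eq_sub_iff_add_eq]
  calc _ = (a y).curryLeft ((fderiv ℝ v y) (u y)) + (((fderiv ℝ a y) (u y)).curryLeft (v y) +
      ((a y).curryLeft ((fderiv ℝ u y) (v y)) +
        alternatizeUncurryFin (((a y).curryLeft (v y)).curryLeft.comp (fderiv ℝ u y)))) := by abel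
    _ = _ := by rw [← c3, add_zero]

end Local

section Contraction

open ContinuousAlternatingMap
variable {E : Type*} [NormedAddCommGroup E] [NormedSpace ℝ E]
variable {M : Type*} [TopologicalSpace M] [ChartedSpace E M]

/-- The pointwise contraction of a form with a vector field. -/
def contractFun {k : ℕ} (v : ∀ p : M, TangentSpace 𝓘(ℝ, E) p)
    (α : ∀ p : M, TangentSpace 𝓘(ℝ, E) p [⋀^Fin (k + 1)]→L[ℝ] ℝ) (p : M) :
    TangentSpace 𝓘(ℝ, E) p [⋀^Fin k]→L[ℝ] ℝ :=
  curryLeft (E := E) (α p) (v p)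

variable [IsManifold 𝓘(ℝ, E) ∞ M]

theorem localRep_contractFun {k : ℕ} (v : VField E M)
    (α : ∀ p : M, TangentSpace 𝓘(ℝ, E) p [⋀^Fin (k + 1)]→L[ℝ] ℝ) (x₀ : M) {y : E}
    (hy : y ∈ (extChartAt 𝓘(ℝ, E) x₀).target) :
    localRep (contractFun v α) x₀ y = (localRep α x₀ y).curryLeft (vRep v x₀ y) := by
  ext w
  set q := (extChartAt 𝓘(ℝ, E) x₀).symm y with hq
  have hqs : q ∈ (extChartAt 𝓘(ℝ, E) x₀).source := (extChartAt 𝓘(ℝ, E) x₀).map_target hy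
  change α q (Matrix.vecCons (v q) fun i =>
      mfderiv 𝓘(ℝ, E) 𝓘(ℝ, E) (extChartAt 𝓘(ℝ, E) x₀).symm y (w i)) =
    α q (fun i => mfderiv 𝓘(ℝ, E) 𝓘(ℝ, E) (extChartAt 𝓘(ℝ, E) x₀).symm y
      ((Matrix.vecCons (vRep v x₀ y) w : Fin (k + 1) → E) i))
  congr 1
  funext i
  refine Fin.cases ?_ (fun i => rfl) i
  have h := mfderiv_symm_comp_chart x₀ hqs (v q)
  rw [hq, (extChartAt 𝓘(ℝ, E) x₀).right_inv hy] at h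
  exact h.symm

theorem eventually_localRep_contractFun {k : ℕ} (v : VField E M)
    (α : ∀ p : M, TangentSpace 𝓘(ℝ, E) p [⋀^Fin (k + 1)]→L[ℝ] ℝ) (x₀ : M) {y : E}
    (hy : y ∈ (extChartAt 𝓘(ℝ, E) x₀).target) :
    localRep (contractFun v α) x₀ =ᶠ[𝓝 y]
      fun z => (localRep α x₀ z).curryLeft (vRep v x₀ z) := by
  filter_upwards [(isOpen_extChartAt_target (I := 𝓘(ℝ, E)) x₀).mem_nhds hy] with z hz
  exact localRep_contractFun v α x₀ hz

theorem contDiffAt_vRep (v : VField E M) (x₀ : M) {y : E}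
    (hy : y ∈ (extChartAt 𝓘(ℝ, E) x₀).target) : ContDiffAt ℝ ∞ (vRep v x₀) y :=
  (contDiffOn_vRep v x₀).contDiffAt ((isOpen_extChartAt_target x₀).mem_nhds hy)

theorem contDiffAt_curryLeft {k : ℕ} {a : E → E [⋀^Fin (k + 1)]→L[ℝ] ℝ} {y : E}
    (h : ContDiffAt ℝ ∞ a y) : ContDiffAt ℝ ∞ (fun z => (a z).curryLeft) y := by
  have h1 : ContDiff ℝ ∞ (curryLeftLI (𝕜 := ℝ) (E := E) (F := ℝ) (n := k)) :=
    ContinuousLinearMap.contDiff (𝕜 := ℝ) (E := E [⋀^Fin (k + 1)]→L[ℝ] ℝ)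
      (F := E →L[ℝ] (E [⋀^Fin k]→L[ℝ] ℝ))
      (curryLeftLI (𝕜 := ℝ) (E := E) (F := ℝ) (n := k)).toContinuousLinearMap
  exact h1.contDiffAt.comp y h

/-- The interior product. -/
def contract (k : ℕ) : VField E M →ₗ[ℝ] Form E M (k + 1) →ₗ[ℝ] Form E M k :=
  LinearMap.mk₂ ℝ (fun v α => ⟨contractFun v α.1, fun x₀ y hy => by
      refine (ContDiffAt.congr_of_eventuallyEq ?_
        (eventually_localRep_contractFun v α.1 x₀ hy)).contDiffWithinAt
      have h1 : ContDiffAt ℝ ∞ (fun z => (localRep α.1 x₀ z).curryLeft) y :=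
        contDiffAt_curryLeft (contDiffAt_localRep α x₀ hy)
      exact h1.clm_apply (contDiffAt_vRep v x₀ hy)⟩)
    (fun v v' α => by
      ext p : 2
      exact (curryLeft (E := E) (α.1 p)).map_add (v p) (v' p))
    (fun c v α => by
      ext p : 2
      exact (curryLeft (E := E) (α.1 p)).map_smul c (v p))
    (fun v α β => rfl) (fun c v α => rfl)

theorem contract_comm {k : ℕ} (u v : VField E M) (α : Form E M (k + 2)) :
    contract k u (contract (k + 1) v α) = - contract k v (contract (k + 1) u α) := by
  ext p w
  have h3 := (α.1 p).map_swap (Matrix.vecCons (v p) (Matrix.vecCons (u p) w))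
      (i := 0) (j := 1) (by simp)
  have h4 : Matrix.vecCons (v p) (Matrix.vecCons (u p) w) ∘ ⇑(Equiv.swap 0 1) =
      Matrix.vecCons (u p) (Matrix.vecCons (v p) w) := by
    ext j
    refine Fin.cases (by simp) (fun j => ?_) j
    refine Fin.cases (by simp) (fun j => ?_) j
    have : Equiv.swap (0 : Fin (k + 2)) 1 j.succ.succ = j.succ.succ :=
      Equiv.swap_apply_of_ne_of_ne (by simp) (by simp [Fin.ext_iff])
    simp [this]
  rw [h4] at h3
  exact (neg_eq_iff_eq_neg.2 h3).symm

/-- The Lie bracket of smooth vector fields. -/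
def lieVF [CompleteSpace E] (u v : VField E M) : VField E M :=
  ⟨VectorField.mlieBracket 𝓘(ℝ, E) u v, by
    have : IsManifold 𝓘(ℝ, E) (minSmoothness ℝ 2) M :=
      IsManifold.of_le (n := ∞) minSmoothness_two_le
    have : IsManifold 𝓘(ℝ, E) (∞ + 1) M := IsManifold.of_le (n := ∞) (by simp)
    exact ContDiff.mlieBracket_vectorField (m := (⊤ : ℕ∞)) (n := (⊤ : ℕ∞)) u.contMDiff v.contMDiff
      (by rw [minSmoothness_of_isRCLikeNormedField]; simp)⟩

theorem vRep_lieVF [CompleteSpace E] (u v : VField E M) (p : M) :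
    vRep (lieVF u v) p (extChartAt 𝓘(ℝ, E) p p) =
      VectorField.lieBracket ℝ (vRep u p) (vRep v p) (extChartAt 𝓘(ℝ, E) p p) := by
  have key (w : VField E M) :
      VectorField.mpullbackWithin 𝓘(ℝ, E) 𝓘(ℝ, E) (extChartAt 𝓘(ℝ, E) p).symm w univ
        =ᶠ[𝓝 (extChartAt 𝓘(ℝ, E) p p)] vRep w p := by
    filter_upwards [(isOpen_extChartAt_target (I := 𝓘(ℝ, E)) p).mem_nhds
      (mem_extChartAt_target p)] with z hz
    rw [VectorField.mpullbackWithin_apply, mfderivWithin_univ, vRep]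
    congr 1
    apply ContinuousLinearMap.inverse_eq
    · ext w
      have hqs : (extChartAt 𝓘(ℝ, E) p).symm z ∈ (extChartAt 𝓘(ℝ, E) p).source :=
        (extChartAt 𝓘(ℝ, E) p).map_target hz
      have h := mfderiv_symm_comp_chart p hqs w
      rw [(extChartAt 𝓘(ℝ, E) p).right_inv hz] at h
      exact h
    · ext w
      exact mfderiv_chart_symm_comp p hz w
  have h1 : VectorField.mlieBracket 𝓘(ℝ, E) u v p =
      (mfderiv 𝓘(ℝ, E) 𝓘(ℝ, E) (extChartAt 𝓘(ℝ, E) p) p).inverse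
        (show E from
          VectorField.lieBracket ℝ (vRep u p) (vRep v p) (extChartAt 𝓘(ℝ, E) p p)) := by
    rw [VectorField.mlieBracket, VectorField.mlieBracketWithin_apply]
    simp only [preimage_univ, univ_inter, modelWithCornersSelf_coe, range_id]
    refine congrArg _ ?_
    refine Eq.trans (congrFun (VectorField.lieBracketWithin_univ (𝕜 := ℝ)) _) ?_
    exact (key u).lieBracket_vectorField_eq (key v)
  have h2 : vRep (lieVF u v) p (extChartAt 𝓘(ℝ, E) p p) =
      mfderiv 𝓘(ℝ, E) 𝓘(ℝ, E) (extChartAt 𝓘(ℝ, E) p) p (lieVF u v p) := by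
    have h3 (q : M) (hq : q = p) : (mfderiv 𝓘(ℝ, E) 𝓘(ℝ, E) (extChartAt 𝓘(ℝ, E) p) q
        (lieVF u v q) : E) = mfderiv 𝓘(ℝ, E) 𝓘(ℝ, E) (extChartAt 𝓘(ℝ, E) p) p (lieVF u v p) := by
      subst hq; rfl
    exact h3 _ (extChartAt_to_inv (I := 𝓘(ℝ, E)) p)
  have h4 : (mfderiv 𝓘(ℝ, E) 𝓘(ℝ, E) (extChartAt 𝓘(ℝ, E) p) p).IsInvertible :=
    isInvertible_mfderiv_extChartAt (mem_extChartAt_source p)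
  refine h2.trans ((congrArg (mfderiv 𝓘(ℝ, E) 𝓘(ℝ, E) (extChartAt 𝓘(ℝ, E) p) p) h1).trans ?_)
  exact h4.self_apply_inverse _

theorem extD_contract_contract [CompleteSpace E] {k : ℕ} (u v : VField E M)
    (α : Form E M (k + 2)) (h0 : extD _ α = 0) (hu : extD _ (contract (k + 1) u α) = 0)
    (hv : extD _ (contract (k + 1) v α) = 0) :
    extD _ (contract k u (contract (k + 1) v α)) = contract (k + 1) (lieVF u v) α := by
  have key {j : ℕ} (β : Form E M j) (p : M) (hβ : extD _ β = 0) :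
      extDeriv (localRep β.1 p) (extChartAt 𝓘(ℝ, E) p p) = 0 := by
    rw [← localRep_extDerivFun β p (mem_extChartAt_target p)]
    have : extDerivFun β.1 = 0 := congrArg Subtype.val hβ
    rw [this]; rfl
  ext p : 2
  have h := mem_extChartAt_target (I := 𝓘(ℝ, E)) p
  apply localRep_injective
  refine (localRep_extDerivFun (contract k u (contract (k + 1) v α)) p h).trans ?_
  refine Eq.trans ?_ (localRep_contractFun (lieVF u v) α.1 p h).symm
  rw [vRep_lieVF]
  have e1 (w : VField E M) := eventually_localRep_contractFun w α.1 p h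
  have e2 : localRep (contract k u (contract (k + 1) v α)).1 p
      =ᶠ[𝓝 (extChartAt 𝓘(ℝ, E) p p)]
      fun z => ((localRep α.1 p z).curryLeft (vRep v p z)).curryLeft (vRep u p z) := by
    filter_upwards [eventually_localRep_contractFun u (contract (k + 1) v α).1 p h, e1 v]
      with z h1 h2
    refine h1.trans ?_
    exact congrArg (fun b => b.curryLeft (vRep u p z)) h2
  rw [e2.extDeriv_eq]
  refine extDeriv_ins_ins ((contDiffAt_localRep α p h).differentiableAt (by simp))
    ((contDiffAt_vRep u p h).differentiableAt (by simp))
    ((contDiffAt_vRep v p h).differentiableAt (by simp)) (key α p h0) ?_ ?_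
  · rw [← (e1 u).extDeriv_eq]; exact key _ p hu
  · rw [← (e1 v).extDeriv_eq]; exact key _ p hv

end Contraction

section Total

variable {E : Type*} [NormedAddCommGroup E] [NormedSpace ℝ E]
variable {M : Type*} [TopologicalSpace M] [ChartedSpace E M]

variable (E M) in
/-- All differential forms on `M`, `Ω(M) = ⨁ Ω^k(M)`; since `Ω^k(M) = 0` for `k > dim M`, when `M`
is finite-dimensional the direct sum is the product. -/
def TotForm : Type _ := ∀ k : ℕ, Form E M k

instance : AddCommGroup (TotForm E M) := inferInstanceAs (AddCommGroup (∀ k : ℕ, Form E M k))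

instance : Module ℝ (TotForm E M) := inferInstanceAs (Module ℝ (∀ k : ℕ, Form E M k))

/-- A `k`-form as an element of `Ω(M)`. -/
def toTot {k : ℕ} (α : Form E M k) : TotForm E M :=
  Pi.single (M := fun k => Form E M k) k α

theorem toTot_same {k : ℕ} (α : Form E M k) : toTot α k = α :=
  Pi.single_eq_same (M := fun k => Form E M k) k α

theorem toTot_of_ne {k j : ℕ} (α : Form E M k) (h : j ≠ k) : toTot α j = 0 :=
  Pi.single_eq_of_ne (M := fun k => Form E M k) h α

variable (E M) in
/-- The forms that are homogeneous of degree `j` (only `0` when `j < 0`). -/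
def homogForm (j : ℤ) : Submodule ℝ (TotForm E M) where
  carrier := {α | ∀ k : ℕ, (k : ℤ) ≠ j → α k = 0}
  zero_mem' := fun _ _ => rfl
  add_mem' := fun {a b} ha hb k hk => by
    change a k + b k = 0
    rw [ha k hk, hb k hk, add_zero]
  smul_mem' := fun c a ha k hk => by
    change c • a k = 0
    rw [ha k hk]
    exact smul_zero c

variable [IsManifold 𝓘(ℝ, E) ∞ M]

/-- The de Rham differential of `Ω(M)`. -/
def totD : TotForm E M →ₗ[ℝ] TotForm E M where
  toFun α
    | 0 => 0
    | k + 1 => extD k (α k)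
  map_add' α β := by
    funext k
    cases k with
    | zero => exact (add_zero _).symm
    | succ k => exact map_add (extD k) _ _
  map_smul' c α := by
    funext k
    cases k with
    | zero => exact (smul_zero (A := Form E M 0) c).symm
    | succ k => exact map_smul (extD k) _ _

theorem totD_totD (α : TotForm E M) : totD (totD α) = 0 := by
  funext k
  match k with
  | 0 => rfl
  | 1 => exact map_zero (extD 0)
  | k + 2 => exact extD_extD (α k)

theorem totD_mem {j : ℤ} {α : TotForm E M} (h : α ∈ homogForm E M j) :
    totD α ∈ homogForm E M (j + 1) := by
  intro k hk
  cases k with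
  | zero => rfl
  | succ k =>
    change extD k (α k) = 0
    rw [h k (by push_cast at hk; omega), map_zero]

/-- The contraction `ι_v` on `Ω(M)`, which is zero on functions. -/
def contr : VField E M →ₗ[ℝ] TotForm E M →ₗ[ℝ] TotForm E M :=
  LinearMap.mk₂ ℝ (fun v α k => contract k v (α (k + 1)))
    (fun v w α => by funext k; exact LinearMap.map_add₂ (contract k) v w _)
    (fun c v α => by funext k; exact LinearMap.map_smul₂ (contract k) c v _)
    (fun v α β => by funext k; exact map_add (contract k v) _ _)
    (fun c v α => by funext k; exact map_smul (contract k v) _ _)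

theorem contr_mem {j : ℤ} (v : VField E M) {α : TotForm E M} (h : α ∈ homogForm E M j) :
    contr v α ∈ homogForm E M (j - 1) := by
  intro k hk
  change contract k v (α (k + 1)) = 0
  rw [h (k + 1) (by push_cast; omega), map_zero]

theorem contr_comm (u v : VField E M) (α : TotForm E M) :
    contr u (contr v α) = -contr v (contr u α) := by
  funext k
  exact contract_comm u v (α (k + 2))

/-- `multiContr k α (v₁, …, v_k) = ι(v₁ ∧ ⋯ ∧ v_k) α = ι_{v_k} ⋯ ι_{v₁} α`. -/
def multiContr : ∀ k : ℕ, TotForm E M →ₗ[ℝ]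
    MultilinearMap ℝ (fun _ : Fin k => VField E M) (TotForm E M)
  | 0 =>
    { toFun := fun α => MultilinearMap.constOfIsEmpty ℝ _ α
      map_add' := fun _ _ => rfl
      map_smul' := fun _ _ => rfl }
  | k + 1 => (multilinearCurryLeftEquiv ℝ (fun _ : Fin (k + 1) => VField E M)
      (TotForm E M)).symm.toLinearMap ∘ₗ contr.flip.compr₂ (multiContr k)

theorem multiContr_succ (k : ℕ) (α : TotForm E M) (v : Fin (k + 1) → VField E M) :
    multiContr (k + 1) α v = multiContr k (contr (v 0) α) (Fin.tail v) := rfl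

theorem multiContr_two (α : TotForm E M) (v : Fin 2 → VField E M) :
    multiContr 2 α v = contr (v 1) (contr (v 0) α) := rfl

theorem multiContr_mem (k : ℕ) {j : ℤ} {α : TotForm E M} (h : α ∈ homogForm E M j)
    (v : Fin k → VField E M) : multiContr k α v ∈ homogForm E M (j - k) := by
  induction k generalizing j α with
  | zero =>
    change α ∈ _
    simpa using h
  | succ k ih =>
    rw [multiContr_succ]
    have := ih (contr_mem (v 0) h) (Fin.tail v)
    convert! this using 2
    push_cast; ring

theorem totD_contr_contr [CompleteSpace E] (u v : VField E M) (α : TotForm E M) (h1 : α 1 = 0)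
    (h0 : totD α = 0) (hu : totD (contr u α) = 0) (hv : totD (contr v α) = 0) :
    totD (contr u (contr v α)) = contr (lieVF u v) α := by
  funext k
  cases k with
  | zero =>
    change (0 : Form E M 0) = contract 0 _ (α 1)
    rw [h1, map_zero]
  | succ k =>
    exact extD_contract_contract u v (α (k + 2)) (congrFun h0 (k + 3)) (congrFun hu (k + 2))
      (congrFun hv (k + 2))

end Total

section Observables

variable {E : Type*} [NormedAddCommGroup E] [NormedSpace ℝ E]
variable {M : Type*} [TopologicalSpace M] [ChartedSpace E M] [IsManifold 𝓘(ℝ, E) ∞ M]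

variable (E M) in
/-- A pre-`n`-plectic structure on `M`: a closed `(n+1)`-form. -/
structure PrePlectic (n : ℕ) where
  /-- the form -/
  form : Form E M (n + 1)
  closed : extD (n + 1) form = 0

namespace PrePlectic

variable {n : ℕ} (P : PrePlectic E M n)

/-- The defining form as an element of `Ω(M)`. -/
def total : TotForm E M := toTot P.form

theorem total_mem : P.total ∈ homogForm E M (n + 1) := fun k hk =>
  toTot_of_ne P.form (j := k) (by omega)

theorem totD_total : totD P.total = 0 := by
  funext k
  cases k with
  | zero => rfl
  | succ k =>
    change extD k (toTot P.form k) = 0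
    by_cases h : k = n + 1
    · subst h
      rw [toTot_same]
      exact P.closed
    · rw [toTot_of_ne P.form h, map_zero]

/-- `v` is a Hamiltonian vector field for `α`. -/
def IsHamVF (v : VField E M) (α : TotForm E M) : Prop := totD α = -contr v P.total

/-- The Hamiltonian `(n-1)`-forms. -/
def ham : Submodule ℝ (TotForm E M) where
  carrier := {α | α ∈ homogForm E M (n - 1) ∧ ∃ v, P.IsHamVF v α}
  zero_mem' := ⟨zero_mem _, 0, by simp [IsHamVF]⟩
  add_mem' := by
    rintro a b ⟨ha, v, hv⟩ ⟨hb, w, hw⟩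
    refine ⟨add_mem ha hb, v + w, ?_⟩
    rw [IsHamVF, map_add, hv, hw, map_add, LinearMap.add_apply, neg_add]
  smul_mem' := by
    rintro c a ⟨ha, v, hv⟩
    refine ⟨Submodule.smul_mem _ c ha, c • v, ?_⟩
    rw [IsHamVF, map_smul, hv, map_smul, LinearMap.smul_apply, smul_neg]

/-- The graded vector space underlying `L_∞(M, ω)`. -/
def obs (i : ℤ) : Submodule ℝ (TotForm E M) :=
  if i = 0 then P.ham
  else if -n + 1 ≤ i ∧ i < 0 then homogForm E M (n - 1 + i)
  else ⊥

theorem obs_zero : P.obs 0 = P.ham := if_pos rfl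

theorem totD_mem_obs {i : ℤ} (hi : i < 0) {α : TotForm E M} (h : α ∈ P.obs i) :
    totD α ∈ P.obs (i + 1) := by
  rw [obs, if_neg hi.ne] at h
  split_ifs at h with h1
  · have h2 := totD_mem h
    rw [obs]
    split_ifs with h3 h4
    · refine ⟨?_, 0, ?_⟩
      · convert! h2 using 2
        omega
      · rw [IsHamVF, totD_totD, map_zero, LinearMap.zero_apply, neg_zero]
    · convert! h2 using 2
      omega
    · exact absurd ⟨by omega, by omega⟩ h4
  · rw [(Submodule.mem_bot ℝ).1 h, map_zero]
    exact zero_mem _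

/-- The vector fields `v` such that `ι_v ω` is closed. -/
def symp : Submodule ℝ (VField E M) := LinearMap.ker (totD ∘ₗ contr.flip P.total)

theorem exists_hamVF : ∃ X : P.ham →ₗ[ℝ] VField E M, ∀ α, P.IsHamVF (X α) α.1 := by
  let q : VField E M →ₗ[ℝ] TotForm E M := -contr.flip P.total
  obtain ⟨g, hg⟩ := LinearMap.exists_rightInverse_of_surjective q.rangeRestrict
    (LinearMap.range_rangeRestrict q)
  let D : P.ham →ₗ[ℝ] LinearMap.range q := (totD ∘ₗ P.ham.subtype).codRestrict _ (by
    rintro ⟨α, h, v, hv⟩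
    exact ⟨v, hv.symm⟩)
  refine ⟨g ∘ₗ D, fun α => ?_⟩
  have := congrArg Subtype.val (LinearMap.congr_fun hg (D α))
  exact this.symm

/-- A choice, linear in `α`, of a Hamiltonian vector field `v_α` for every Hamiltonian form `α`.
The brackets of `L_∞(M, ω)` do not depend on it, see `multiContr_congr`. -/
def hamVF : P.ham →ₗ[ℝ] P.symp :=
  P.exists_hamVF.choose.codRestrict P.symp fun α => by
    have h := P.exists_hamVF.choose_spec α
    change totD (contr _ P.total) = 0
    rw [← neg_eq_zero, ← map_neg, ← h, totD_totD]

theorem isHamVF_hamVF (α : P.ham) : P.IsHamVF (P.hamVF α) α.1 := P.exists_hamVF.choose_spec α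

theorem multiContr_mem_obs [CompleteSpace E] {k : ℕ} (hk : 2 ≤ k) (v : Fin k → P.symp) :
    multiContr k P.total (fun i => (v i : VField E M)) ∈ P.obs (2 - k) := by
  have h := multiContr_mem k P.total_mem (fun i => (v i : VField E M))
  rw [obs]
  split_ifs with h1 h2
  · obtain rfl : k = 2 := by omega
    refine ⟨?_, ?_⟩
    · have e : (n : ℤ) + 1 - (2 : ℕ) = n - 1 := by push_cast; ring
      rw [← e]
      exact h
    · rw [multiContr_two] at h ⊢
      generalize v 0 = a at *
      generalize v 1 = b at *
      cases n with
      | zero =>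
        refine ⟨0, ?_⟩
        have h2 : contr (b : VField E M) (contr (a : VField E M) P.total) = 0 := by
          funext j
          exact h j (by push_cast; omega)
        rw [h2, IsHamVF, map_zero, map_zero, LinearMap.zero_apply, neg_zero]
      | succ n =>
        refine ⟨-lieVF b.1 a.1, ?_⟩
        rw [IsHamVF, totD_contr_contr _ _ _ (P.total_mem 1 (by push_cast; omega)) P.totD_total
          b.2 a.2, map_neg, LinearMap.neg_apply, neg_neg]
  · have e : (n : ℤ) + 1 - k = n - 1 + (2 - k) := by ring
    rw [← e]
    exact h
  · rw [Submodule.mem_bot]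
    funext j
    exact h j (by omega)

end PrePlectic

theorem multiContr_congr (k : ℕ) (α : TotForm E M) (v w : Fin k → VField E M)
    (h : ∀ i, contr (v i) α = contr (w i) α) : multiContr k α v = multiContr k α w := by
  induction k generalizing α with
  | zero => rfl
  | succ k ih =>
    rw [multiContr_succ, multiContr_succ, h 0]
    refine ih _ _ _ fun i => ?_
    change contr (v i.succ) (contr (w 0) α) = contr (w i.succ) (contr (w 0) α)
    rw [contr_comm, h, ← contr_comm]

end Observables

section LInfty

open DirectSum
open scoped BigOperators

/-- The data of an `L_∞`-algebra: a `ℤ`-graded real vector space, presented as the direct sum of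
a family of spaces `L a` placed in degree `deg a`, with multibrackets `l_k = br k` for `k ≥ 1`
(`br 0` plays no role). The notions below of morphism and of homotopy only mention this data. -/
structure LInftyData where
  /-- the index set of the summands -/
  ι : Type
  decEq : DecidableEq ι
  /-- the degree of a summand -/
  deg : ι → ℤ
  /-- the summands -/
  L : ι → Type*
  addCommGroup : ∀ a, AddCommGroup (L a)
  module : ∀ a, Module ℝ (L a)
  /-- the multibrackets -/
  br : ∀ k : ℕ, MultilinearMap ℝ (fun _ : Fin k => ⨁ a, L a) (⨁ a, L a)

namespace LInftyData

attribute [instance] decEq addCommGroup module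

/-- The underlying vector space. -/
abbrev Total (A : LInftyData) : Type _ := ⨁ a, A.L a

/-- The elements that are homogeneous of degree `d`. -/
def homog (A : LInftyData) (d : ℤ) : Submodule ℝ A.Total where
  carrier := {v | ∀ a, A.deg a ≠ d → v a = 0}
  zero_mem' := fun _ _ => rfl
  add_mem' := fun {v w} hv hw a ha => by
    rw [DirectSum.add_apply, hv a ha, hw a ha, add_zero]
  smul_mem' := fun c v hv a ha => by
    rw [DirectSum.smul_apply, hv a ha, smul_zero]

end LInftyData

/-- The values of a multilinear map transported to the shifted space `L[1]`, at arguments `x i` of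
degrees `d i`: `s⁻¹x₀, …, s⁻¹x_{k-1} ↦ (-1)^(Σ (k-1-j) d_j) g (x₀, …, x_{k-1})`. -/
def shifted {V W : Type*} [AddCommGroup V] [Module ℝ V] [AddCommGroup W] [Module ℝ W] {k : ℕ}
    (g : MultilinearMap ℝ (fun _ : Fin k => V) W) (d : Fin k → ℤ) (x : Fin k → V) : W :=
  (-1 : ℝ) ^ (∑ j : Fin k, ((k : ℤ) - 1 - (j : ℕ)) * d j) • g x

/-- The restriction of a tuple to a set `S` of positions, in increasing order. -/
def subTuple {m : ℕ} {X : Type*} (x : Fin m → X) (S : Finset (Fin m)) : Fin S.card → X :=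
  x ∘ S.orderEmbOfFin rfl

open Finset in
/-- The Koszul sign, in the shifted degrees `d i - 1`, of bringing the arguments in `I` to
the front. -/
def unshuffleSign {m : ℕ} (d : Fin m → ℤ) (I : Finset (Fin m)) : ℝ :=
  ∏ i ∈ I, ∏ j ∈ Iᶜ with j < i, (-1 : ℝ) ^ ((d i - 1) * (d j - 1))

open Finset in
/-- The Koszul sign, in the shifted degrees `d i - 1`, of grouping the arguments into the blocks
`p⁻¹(0), p⁻¹(1), …`. -/
def blockSign {m r : ℕ} (d : Fin m → ℤ) (p : Fin m → Fin r) : ℝ :=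
  ∏ j, ∏ i with i < j ∧ p j < p i, (-1 : ℝ) ^ ((d i - 1) * (d j - 1))

open Finset in
/-- The block `p⁻¹(b)`. -/
def block {m r : ℕ} (p : Fin m → Fin r) (b : Fin r) : Finset (Fin m) := {i | p i = b}

open Finset in
open Classical in
/-- An `L_∞`-morphism `A ⇝ B`, with components `f_k = comp k` for `k ≥ 1`. The component `f_k` has
degree `1 - k` and is graded skew-symmetric, and for all `m ≥ 1` and all homogeneous
`x₁, …, x_m`, written on the shifted spaces `A[1]` and `B[1]`,
`Σ_{I ≠ ∅} ± f_{m-|I|+1}(l_{|I|}(x_I), x_{Iᶜ}) =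
  Σ_r (1/r!) Σ_{p : {1..m} ↠ {1..r}} ± l_r(f(x_{p⁻¹(1)}), …, f(x_{p⁻¹(r)}))`. -/
structure LInftyHom (A B : LInftyData) where
  /-- the components -/
  comp : ∀ k : ℕ, MultilinearMap ℝ (fun _ : Fin k => A.Total) B.Total
  degree : ∀ (k : ℕ) (d : Fin k → ℤ) (x : Fin k → A.Total), 1 ≤ k → (∀ i, x i ∈ A.homog (d i)) →
    comp k x ∈ B.homog (∑ i, d i + 1 - k)
  skew : ∀ (k : ℕ) (d : Fin k → ℤ) (x : Fin k → A.Total), (∀ i, x i ∈ A.homog (d i)) →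
    ∀ i j : Fin k, (i : ℕ) + 1 = j →
      comp k (x ∘ Equiv.swap i j) = -(-1 : ℝ) ^ (d i * d j) • comp k x
  eqn : ∀ (m : ℕ) (d : Fin m → ℤ) (x : Fin m → A.Total), 1 ≤ m → (∀ i, x i ∈ A.homog (d i)) →
    ∑ I : Finset (Fin m) with I.Nonempty, unshuffleSign d I •
        shifted (comp (Iᶜ.card + 1))
          (Fin.cons (∑ i ∈ I, d i + 2 - I.card) (subTuple d Iᶜ))
          (Fin.cons (shifted (A.br I.card) (subTuple d I) (subTuple x I)) (subTuple x Iᶜ)) =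
      ∑ r ∈ Finset.Icc 1 m, (r.factorial : ℝ)⁻¹ •
        ∑ p : Fin m → Fin r with Function.Surjective p, blockSign d p •
          shifted (B.br r) (fun b => ∑ i ∈ block p b, d i + 1 - (block p b).card)
            (fun b => shifted (comp (block p b).card) (subTuple d (block p b)) (subTuple x (block p b)))

/-- The Lie bracket as a multilinear map. -/
def bracketMulti (𝔤 : Type*) [LieRing 𝔤] [LieAlgebra ℝ 𝔤] :
    MultilinearMap ℝ (fun _ : Fin 2 => 𝔤) 𝔤 :=
  MultilinearMap.mk' (fun x => ⁅x 0, x 1⁆)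
    (by intro x i y z; fin_cases i <;> simp)
    (by intro x i c y; fin_cases i <;> simp)

/-- A Lie algebra as an `L_∞`-algebra concentrated in degree `0`, whose only multibracket is
`l₂ = [ , ]`. -/
def lieData (𝔤 : Type*) [LieRing 𝔤] [LieAlgebra ℝ 𝔤] : LInftyData where
  ι := Unit
  decEq := inferInstance
  deg := fun _ => 0
  L := fun _ => 𝔤
  addCommGroup := fun _ => inferInstance
  module := fun _ => inferInstance
  br := fun k =>
    match k with
    | 2 => (lof ℝ Unit (fun _ => 𝔤) ()).compMultilinearMap
        ((bracketMulti 𝔤).compLinearMap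
          fun _ => DirectSum.component ℝ Unit (fun _ => 𝔤) ())
    | _ => 0

/-- Tensoring with a monomial form: `mono j e` is the map
`γ ↦ γ ⊗ t^j (dt)^e` into `A ⊗ Ω(ℝ)`. -/
def LInftyData.mono (A : LInftyData) (j : ℕ) (e : Fin 2) :
    A.Total →ₗ[ℝ] ⨁ a : A.ι × ℕ × Fin 2, A.L a.1 :=
  toModule ℝ A.ι _ fun a => lof ℝ (A.ι × ℕ × Fin 2) (fun a => A.L a.1) (a, j, e)

/-- The differential of `A ⊗ Ω(ℝ)`:
`γ ⊗ Γ ↦ l₁(γ) ⊗ Γ + (-1)^(deg γ) γ ⊗ dΓ`, where `d(t^j) = j t^(j-1) dt` and `d(t^j dt) = 0`. -/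
def LInftyData.tensorDiff (A : LInftyData) :
    (⨁ a : A.ι × ℕ × Fin 2, A.L a.1) →ₗ[ℝ] ⨁ a : A.ι × ℕ × Fin 2, A.L a.1 :=
  toModule ℝ (A.ι × ℕ × Fin 2) _ fun a =>
    A.mono a.2.1 a.2.2 ∘ₗ (A.br 1).toLinearMap (fun _ => 0) 0 ∘ₗ lof ℝ A.ι A.L a.1 +
      if a.2.2 = 0 then
        ((-1 : ℝ) ^ A.deg a.1 * a.2.1) •
          lof ℝ (A.ι × ℕ × Fin 2) (fun a => A.L a.1) (a.1, a.2.1 - 1, 1)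
      else 0

open Finset in
/-- The multibrackets of `A ⊗ Ω(ℝ)` for `k ≥ 2`:
`(γ₁ ⊗ Γ₁, …, γ_k ⊗ Γ_k) ↦ ± l_k(γ₁, …, γ_k) ⊗ Γ₁ ⋯ Γ_k`, where `±` is the Koszul sign of moving
each `Γ_i` to the right of `γ_{i+1}, …, γ_k`. -/
def LInftyData.tensorBr (A : LInftyData) (k : ℕ) :
    MultilinearMap ℝ (fun _ : Fin k => ⨁ a : A.ι × ℕ × Fin 2, A.L a.1)
      (⨁ a : A.ι × ℕ × Fin 2, A.L a.1) :=
  MultilinearMap.fromDirectSumEquiv (R := ℝ) fun p : Fin k → A.ι × ℕ × Fin 2 =>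
    if h : ∑ i, ((p i).2.2 : ℕ) < 2 then
      (∏ l, ∏ i with i < l, (-1 : ℝ) ^ (((p i).2.2 : ℕ) * A.deg (p l).1)) •
        (A.mono (∑ i, (p i).2.1) ⟨∑ i, ((p i).2.2 : ℕ), h⟩).compMultilinearMap
          ((A.br k).compLinearMap fun i => lof ℝ A.ι A.L (p i).1)
    else 0

/-- The `L_∞`-algebra `A ⊗ Ω(ℝ)`, where `Ω(ℝ) = ℝ[t] + ℝ[t]dt` is the algebra of polynomial forms
on the line; the summand with index `(a, j, e)` is `A.L a ⊗ t^j (dt)^e`. -/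
def LInftyData.tensorForms (A : LInftyData) : LInftyData where
  ι := A.ι × ℕ × Fin 2
  decEq := inferInstance
  deg := fun a => A.deg a.1 + (a.2.2 : ℕ)
  L := fun a => A.L a.1
  addCommGroup := fun _ => inferInstance
  module := fun _ => inferInstance
  br := fun k =>
    match k with
    | 0 => 0
    | 1 => MultilinearMap.ofSubsingleton ℝ _ _ 0 A.tensorDiff
    | k + 2 => A.tensorBr (k + 2)

/-- The restriction `A ⊗ Ω(ℝ) → A` to `t = s`, `dt = 0`. -/
def LInftyData.evalAt (A : LInftyData) (s : ℝ) : A.tensorForms.Total →ₗ[ℝ] A.Total :=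
  let φ : (⨁ a : A.ι × ℕ × Fin 2, A.L a.1) →ₗ[ℝ] A.Total :=
    toModule ℝ (A.ι × ℕ × Fin 2) _ fun a =>
      if a.2.2 = 0 then s ^ a.2.1 • lof ℝ A.ι A.L a.1 else 0
  φ

/-- Two `L_∞`-morphisms `A ⇝ B` are equivalent if there is an `L_∞`-morphism
`H : A ⇝ B ⊗ Ω(ℝ)` that restricts to them at `t = 0` and at `t = 1`. -/
def LInftyEquivalent {A B : LInftyData} (f f' : LInftyHom A B) : Prop :=
  ∃ H : LInftyHom A B.tensorForms, ∀ k, 1 ≤ k →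
    (B.evalAt 0).compMultilinearMap (H.comp k) = f.comp k ∧
    (B.evalAt 1).compMultilinearMap (H.comp k) = f'.comp k

end LInfty

section ObservablesLInfty

open DirectSum
variable {E : Type*} [NormedAddCommGroup E] [NormedSpace ℝ E] [CompleteSpace E]
variable {M : Type*} [TopologicalSpace M] [ChartedSpace E M] [IsManifold 𝓘(ℝ, E) ∞ M]
variable {n : ℕ} (P : PrePlectic E M n)

/-- The sign `ς(k) = -(-1)^(k(k+1)/2)`. -/
def vs (k : ℕ) : ℝ := -(-1) ^ (k * (k + 1) / 2)

namespace PrePlectic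

/-- The differential of `L_∞(M, ω)`: the de Rham differential in negative degrees, and zero on the
Hamiltonian forms. -/
def obsDiff : (⨁ i, P.obs i) →ₗ[ℝ] ⨁ i, P.obs i :=
  toModule ℝ ℤ _ fun i =>
    if h : i < 0 then
      lof ℝ ℤ (fun i => P.obs i) (i + 1) ∘ₗ totD.restrict fun _ hα => P.totD_mem_obs h hα
    else 0

/-- The multibracket `l_k` of `L_∞(M, ω)` for `k ≥ 2`: it sends Hamiltonian forms `α₁, …, α_k` to
`ς(k) ι(v_{α₁} ∧ ⋯ ∧ v_{α_k}) ω`, in degree `2 - k`, and vanishes if one of its arguments has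
negative degree. -/
def obsBr (k : ℕ) (hk : 2 ≤ k) :
    MultilinearMap ℝ (fun _ : Fin k => ⨁ i, P.obs i) (⨁ i, P.obs i) :=
  (lof ℝ ℤ (fun i => P.obs i) (2 - k)).compMultilinearMap
    (vs k • (((multiContr k P.total).compLinearMap fun _ => P.symp.subtype).codRestrict
      (P.obs (2 - k)) fun v => P.multiContr_mem_obs hk v).compLinearMap
        fun _ => P.hamVF ∘ₗ Submodule.inclusion P.obs_zero.le ∘ₗ
          DirectSum.component ℝ ℤ (fun i => P.obs i) 0)

/-- The `L_∞`-algebra of observables `L_∞(M, ω)`. -/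
def obsData : LInftyData where
  ι := ℤ
  decEq := inferInstance
  deg := fun i => i
  L := fun i => P.obs i
  addCommGroup := fun _ => inferInstance
  module := fun _ => inferInstance
  br := fun k =>
    match k with
    | 0 => 0
    | 1 => MultilinearMap.ofSubsingleton ℝ _ _ 0 P.obsDiff
    | k + 2 => P.obsBr (k + 2) (by omega)

/-- The differential form underlying an element of `L_∞(M, ω)`. -/
def toForm : P.obsData.Total →ₗ[ℝ] TotForm E M :=
  DirectSum.coeLinearMap P.obs

end PrePlectic

end ObservablesLInfty

section Actions

variable {E : Type*} [NormedAddCommGroup E] [NormedSpace ℝ E]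
variable {M : Type*} [TopologicalSpace M] [ChartedSpace E M]
variable {EG : Type*} [NormedAddCommGroup EG] [NormedSpace ℝ EG]
variable {G : Type*} [TopologicalSpace G] [ChartedSpace EG G] [Group G]

instance [LieGroup 𝓘(ℝ, EG) ∞ G] : LieGroup 𝓘(ℝ, EG) (minSmoothness ℝ 3) G :=
  LieGroup.of_le (n := ∞) (by rw [minSmoothness_of_isRCLikeNormedField]; exact ENat.LEInfty.out)

variable [MulAction G M]

variable (G) in
/-- The action of `G` on `M` preserves the form `α`. -/
def IsInvariant {k : ℕ} (α : Form E M k) : Prop :=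
  ∀ (g : G) (p : M), (α.1 (g • p)).compContinuousLinearMap
    (mfderiv 𝓘(ℝ, E) 𝓘(ℝ, E) (fun q : M => g • q) p) = α.1 p

variable (E EG) in
/-- The value at `p` of the infinitesimal generator of `x ∈ 𝔤`, that is
`d/dt|_{t=0} exp(-t x) • p`. -/
def genFun (x : GroupLieAlgebra 𝓘(ℝ, EG) G) (p : M) : TangentSpace 𝓘(ℝ, E) p :=
  (show E from mfderiv 𝓘(ℝ, EG) 𝓘(ℝ, E) (fun g : G => g • p) 1 (-x))

theorem contMDiff_genFun [IsManifold 𝓘(ℝ, E) ∞ M] [LieGroup 𝓘(ℝ, EG) ∞ G]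
    [ContMDiffSMul 𝓘(ℝ, EG) 𝓘(ℝ, E) ∞ G M] (x : GroupLieAlgebra 𝓘(ℝ, EG) G) :
    ContMDiff 𝓘(ℝ, E) 𝓘(ℝ, E).tangent ∞
      (fun p : M => (⟨p, genFun E EG x p⟩ : TangentBundle 𝓘(ℝ, E) M)) := by
  let fg : M → TangentBundle 𝓘(ℝ, EG) G := fun _ => ⟨1, -x⟩
  have sfg : ContMDiff 𝓘(ℝ, E) 𝓘(ℝ, EG).tangent ∞ fg := contMDiff_const
  let fv : M → TangentBundle 𝓘(ℝ, E) M := fun p => ⟨p, 0⟩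
  have sfv : ContMDiff 𝓘(ℝ, E) 𝓘(ℝ, E).tangent ∞ fv :=
    Bundle.contMDiff_zeroSection ℝ (TangentSpace 𝓘(ℝ, E) : M → Type _)
  let F₁ : M → (TangentBundle 𝓘(ℝ, EG) G × TangentBundle 𝓘(ℝ, E) M) := fun p => (fg p, fv p)
  have S₁ := sfg.prodMk sfv
  let F₂ : (TangentBundle 𝓘(ℝ, EG) G × TangentBundle 𝓘(ℝ, E) M) →
      TangentBundle (𝓘(ℝ, EG).prod 𝓘(ℝ, E)) (G × M) :=
    (equivTangentBundleProd 𝓘(ℝ, EG) G 𝓘(ℝ, E) M).symm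
  have S₂ : ContMDiff (𝓘(ℝ, EG).tangent.prod 𝓘(ℝ, E).tangent) (𝓘(ℝ, EG).prod 𝓘(ℝ, E)).tangent ∞
      F₂ := contMDiff_equivTangentBundleProd_symm
  have hs : ContMDiff (𝓘(ℝ, EG).prod 𝓘(ℝ, E)) 𝓘(ℝ, E) ∞ (fun p : G × M => p.1 • p.2) :=
    ContMDiffSMul.contMDiff_smul
  let F₃ : TangentBundle (𝓘(ℝ, EG).prod 𝓘(ℝ, E)) (G × M) → TangentBundle 𝓘(ℝ, E) M :=
    tangentMap (𝓘(ℝ, EG).prod 𝓘(ℝ, E)) 𝓘(ℝ, E) (fun p : G × M => p.1 • p.2)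
  have S₃ : ContMDiff (𝓘(ℝ, EG).prod 𝓘(ℝ, E)).tangent 𝓘(ℝ, E).tangent ∞ F₃ :=
    hs.contMDiff_tangentMap (by simp)
  have S := (S₃.comp S₂).comp S₁
  refine S.congr fun p => ?_
  have h (q : M) (w : E) (hq : p = q) :
      (⟨p, w⟩ : TangentBundle 𝓘(ℝ, E) M) = ⟨q, w⟩ := by subst hq; rfl
  refine (h ((1 : G) • p) (genFun E EG x p) (one_smul G p).symm).trans ?_
  have e := mfderiv_prod_eq_add_apply (p := ((1 : G), p)) (v := ((-x, 0) : EG × E))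
    (hs.mdifferentiableAt (by simp))
  have e0 : mfderiv 𝓘(ℝ, E) 𝓘(ℝ, E) (fun q : M => (1 : G) • q) p 0 = 0 := map_zero _
  have e1 := e.trans ((congrArg (_ + ·) e0).trans (add_zero _))
  exact congrArg (fun w => (⟨(1 : G) • p, w⟩ : TangentBundle 𝓘(ℝ, E) M)) e1.symm

variable (E M EG) in
/-- The infinitesimal generator `v_x` of `x ∈ 𝔤`. -/
def genVF [IsManifold 𝓘(ℝ, E) ∞ M] [LieGroup 𝓘(ℝ, EG) ∞ G]
    [ContMDiffSMul 𝓘(ℝ, EG) 𝓘(ℝ, E) ∞ G M] (x : GroupLieAlgebra 𝓘(ℝ, EG) G) : VField E M :=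
  ⟨genFun E EG x, contMDiff_genFun x⟩

end Actions

section MomentMaps

variable {E : Type*} [NormedAddCommGroup E] [NormedSpace ℝ E] [CompleteSpace E]
variable {M : Type*} [TopologicalSpace M] [ChartedSpace E M] [IsManifold 𝓘(ℝ, E) ∞ M]
variable {n : ℕ}

/-- The value of the `k`-th component of an `L_∞`-morphism `𝔤 ⇝ L_∞(M, ω)` at `x₁, …, x_k`, as a
differential form. -/
def onLie {𝔤 : Type*} [LieRing 𝔤] [LieAlgebra ℝ 𝔤] {P : PrePlectic E M n}
    (f : LInftyHom (lieData 𝔤) P.obsData) (k : ℕ) (x : Fin k → 𝔤) : TotForm E M :=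
  P.toForm (f.comp k fun i => DirectSum.lof ℝ Unit (fun _ => 𝔤) () (x i))

variable (EG : Type*) [NormedAddCommGroup EG] [NormedSpace ℝ EG] [CompleteSpace EG]
variable (G : Type*) [TopologicalSpace G] [ChartedSpace EG G] [Group G] [LieGroup 𝓘(ℝ, EG) ∞ G]
variable [MulAction G M] [ContMDiffSMul 𝓘(ℝ, EG) 𝓘(ℝ, E) ∞ G M]

/-- A homotopy moment map for the action of `G` on `(M, ω)`: an `L_∞`-morphism
`f : 𝔤 ⇝ L_∞(M, ω)` with `d(f₁(x)) = -ι(v_x) ω` for all `x ∈ 𝔤`. -/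
structure HomotopyMomentMap (P : PrePlectic E M n) where
  /-- the underlying morphism -/
  toHom : LInftyHom (lieData (GroupLieAlgebra 𝓘(ℝ, EG) G)) P.obsData
  moment : ∀ x : GroupLieAlgebra 𝓘(ℝ, EG) G,
    totD (onLie toHom 1 fun _ => x) = -contr (genVF E M EG x) P.total

end MomentMaps

section Inner

variable {E : Type*} [NormedAddCommGroup E] [NormedSpace ℝ E]
variable {M : Type*} [TopologicalSpace M] [ChartedSpace E M] [IsManifold 𝓘(ℝ, E) ∞ M]
variable {𝔤 : Type*} [LieRing 𝔤] [LieAlgebra ℝ 𝔤]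

/-- The Chevalley-Eilenberg differential of a cochain `φ = (φ_k)` with values in the trivial
`𝔤`-module `Ω(M)`:
`(d_𝔤 φ)(x₀, …, x_{k+1}) = Σ_{i<j} (-1)^(i+j) φ([x_i, x_j], x₀, …, x̂_i, …, x̂_j, …, x_{k+1})`.
The pairs are written as `i < j + 1`. -/
def ceD (φ : ∀ k : ℕ, 𝔤 [⋀^Fin k]→ₗ[ℝ] TotForm E M) : ∀ k : ℕ, (Fin k → 𝔤) → TotForm E M
  | 0, _ => 0
  | 1, _ => 0
  | k + 2, x => ∑ i : Fin (k + 1), ∑ j ∈ Finset.Ici i, (-1 : ℝ) ^ ((i : ℕ) + ((j : ℕ) + 1)) •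
      φ (k + 1) (Fin.cons ⁅x i.castSucc, x j.succ⁆ (j.removeNth (i.castSucc.removeNth x)))

/-- The total differential `d_tot = d_𝔤 ⊗ 1 + 1 ⊗ d`, which is `d_𝔤 + (-1)^k d` on
`∧^k 𝔤* ⊗ Ω(M)`. -/
def totalD (φ : ∀ k : ℕ, 𝔤 [⋀^Fin k]→ₗ[ℝ] TotForm E M) (k : ℕ) (x : Fin k → 𝔤) : TotForm E M :=
  ceD φ k x + (-1 : ℝ) ^ k • totD (φ k x)

/-- Inner equivalence: with `φ_k = ς(k) f_k` and `φ'_k = ς(k) f'_k`, one has `φ' - φ = d_tot η` for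
an element `η` of total degree `n - 1` of `∧^{≥ 1} 𝔤* ⊗ Ω(M)`. -/
def InnerEquivalent [CompleteSpace E] {n : ℕ} {P : PrePlectic E M n}
    (f f' : LInftyHom (lieData 𝔤) P.obsData) : Prop :=
  ∃ η : ∀ k : ℕ, 𝔤 [⋀^Fin k]→ₗ[ℝ] TotForm E M,
    η 0 = 0 ∧ (∀ (k : ℕ) (x : Fin k → 𝔤), η k x ∈ homogForm E M ((n : ℤ) - 1 - k)) ∧
    ∀ (k : ℕ) (x : Fin k → 𝔤), 1 ≤ k →
      vs k • onLie f' k x - vs k • onLie f k x = totalD η k x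

end Inner

end MomentMaps

end

/-!
Inner equivalence of homotopy moment maps agrees with equivalence of `L_∞`-morphisms.

Since `𝔤` sits in degree `0`, every argument of a morphism `𝔤 ⇝ B` may be taken of degree `0`, and
all Koszul signs depending on the arguments disappear. The left hand side of the equation for
`L_∞`-morphisms is then minus the Chevalley-Eilenberg differential (`bracketSide_lie`), and the
summand `r = 1` of the right hand side is `l₁ f_m` (`blockSide_one`). The other summands are built
from the higher brackets of `L_∞(M, ω)`, which only see the contractions `ι_v ω = -dα` of their
arguments: they vanish as soon as one argument has negative degree or is a closed Hamiltonian form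
(`PrePlectic.isNull_nullObs`). Such arguments are called null.

A homotopy `H : 𝔤 ⇝ L_∞(M, ω) ⊗ Ω(ℝ)` has the form `H_k = A_k(t) + B_k(t) dt`, where `B_k` has
degree `-k < 0` and is therefore null. So the higher brackets of values of `H` have no `dt`-part,
and integrating the `dt`-part of the equation for `H` over `[0, 1]` leaves, by Stokes' theorem on
the interval (`LInftyData.integral_tensorDiff`), the linear equation `IsPrimitive` between
`b = ∫ B dt` and `f' - f`, see `isPrimitive_integral`. Conversely, a solution `b` of that equation
gives the homotopy `(1 - t) f + t f' + b dt`: the terms in `t` and in `dt` are null, so that its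
higher brackets are those of `f` (`equivalent_of_isPrimitive`). Finally, `ς(m) = (-1)^m ς(m - 1)`
turns `IsPrimitive` into `φ' - φ = d_tot η` for `η_k = ς(k) b_k` (`isPrimitive_iff_totalD`).
-/

noncomputable section

namespace MomentMaps

/-! ### Multilinear maps -/

section Multilinear

open DirectSum
variable {V W : Type*} [AddCommGroup V] [Module ℝ V] [AddCommGroup W] [Module ℝ W]

/-- If `g` vanishes as soon as one argument lies in `N`, then it only depends on its arguments
modulo `N`. -/
theorem multilinearMap_eq_of_sub_mem {k : ℕ} (g : MultilinearMap ℝ (fun _ : Fin k => V) W)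
    (N : Submodule ℝ V) (hN : ∀ z : Fin k → V, (∃ i, z i ∈ N) → g z = 0) {x y : Fin k → V}
    (h : ∀ i, x i - y i ∈ N) : g x = g y := by
  have e : x = y + (x - y) := by abel
  rw [e, g.map_add_univ, Finset.sum_eq_single Finset.univ]
  · simp
  · intro s _ hs
    obtain ⟨i, hi⟩ : ∃ i, i ∉ s := by
      by_contra! h'
      exact hs (Finset.eq_univ_iff_forall.2 h')
    exact hN _ ⟨i, by rw [Finset.piecewise_eq_of_notMem _ _ _ hi]; exact h i⟩
  · simp

theorem multilinearMap_eq_zero_of_components {κ : Type*} [DecidableEq κ] {L : κ → Type*}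
    [∀ a, AddCommGroup (L a)] [∀ a, Module ℝ (L a)] {k : ℕ}
    (g : MultilinearMap ℝ (fun _ : Fin k => ⨁ a, L a) W) (z : Fin k → ⨁ a, L a)
    (h : ∀ p : Fin k → κ, g (fun i => lof ℝ κ L (p i) (z i (p i))) = 0) : g z = 0 := by
  classical
  have e : g z = g (fun i => ∑ a ∈ (z i).support, lof ℝ κ L a (z i a)) :=
    congrArg g (funext fun i => (DirectSum.sum_support_of (z i)).symm)
  rw [e, g.map_sum_finset]
  exact Finset.sum_eq_zero fun p _ => h p

/-- A multilinear map that changes sign under the transpositions of neighbours is alternating,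
because these generate the symmetric group. -/
theorem map_eq_zero_of_adjacent_swap {k : ℕ} (g : MultilinearMap ℝ (fun _ : Fin k => V) W)
    (h : ∀ (x : Fin k → V) (i j : Fin k), (i : ℕ) + 1 = j → g (x ∘ Equiv.swap i j) = -g x)
    (x : Fin k → V) (i j : Fin k) (hx : x i = x j) (hij : i ≠ j) : g x = 0 := by
  have key (σ : Equiv.Perm (Fin k)) (x : Fin k → V) :
      g (x ∘ σ) = ((Equiv.Perm.sign σ : ℤ) : ℝ) • g x := by
    cases k with
    | zero => simp [Subsingleton.elim σ 1]
    | succ k =>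
      have hσ : σ ∈ Submonoid.closure
          (Set.range fun i : Fin k => Equiv.swap i.castSucc i.succ) := by
        rw [Equiv.Perm.mclosure_swap_castSucc_succ]; trivial
      induction hσ using Submonoid.closure_induction generalizing x with
      | mem σ hσ =>
        obtain ⟨a, rfl⟩ := hσ
        simp only
        rw [h x _ _ (by simp), Equiv.Perm.sign_swap (by simp [Fin.ext_iff])]
        simp
      | one => simp
      | mul σ τ _ _ hσ hτ =>
        rw [Equiv.Perm.coe_mul, ← Function.comp_assoc, hτ, hσ, smul_smul, map_mul]
        push_cast
        rw [mul_comm]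
  have e := key (Equiv.swap i j) x
  rw [Equiv.Perm.sign_swap hij] at e
  have e2 : x ∘ Equiv.swap i j = x := by
    funext l
    rw [Function.comp_apply, Equiv.swap_apply_def]
    split_ifs with h1 h2
    · rw [h1, hx]
    · rw [h2, hx]
    · rfl
  rw [e2] at e
  simp only [Units.val_neg, Units.val_one, Int.cast_neg, Int.cast_one, neg_smul, one_smul] at e
  have : (2 : ℝ) • g x = 0 := by rw [two_smul]; nth_rewrite 1 [e]; simp
  exact (smul_eq_zero.1 this).resolve_left two_ne_zero

end Multilinear

/-! ### The algebra `A ⊗ Ω(ℝ)` -/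

section Tensor

open DirectSum

namespace LInftyData

/-- The vector space underlying `A ⊗ Ω(ℝ)`. It is `A.tensorForms.Total` with the index set of the
direct sum written out, which `simp` and `rw` need. -/
abbrev TensorTotal (A : LInftyData) : Type _ := ⨁ a : A.ι × ℕ × Fin 2, A.L a.1

variable (A : LInftyData)

/-- Integration over `[0, 1]`, as a map `A ⊗ Ω(ℝ) → A`: `γ ⊗ t^j dt ↦ γ / (j + 1)` and
`γ ⊗ t^j ↦ 0`. -/
def integral : A.TensorTotal →ₗ[ℝ] A.Total :=
  toModule ℝ (A.ι × ℕ × Fin 2) _ fun a =>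
    if a.2.2 = 0 then 0 else ((a.2.1 : ℝ) + 1)⁻¹ • lof ℝ A.ι A.L a.1

theorem integral_lof (a : A.ι) (j : ℕ) (e : Fin 2) (γ : A.L a) :
    A.integral (lof ℝ (A.ι × ℕ × Fin 2) (fun a => A.L a.1) (a, j, e) γ) =
      if e = 0 then 0 else ((j : ℝ) + 1)⁻¹ • lof ℝ A.ι A.L a γ := by
  rw [integral, toModule_lof]
  split_ifs <;> rfl

theorem mono_lof (j : ℕ) (e : Fin 2) (a : A.ι) (γ : A.L a) :
    A.mono j e (lof ℝ A.ι A.L a γ) =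
      lof ℝ (A.ι × ℕ × Fin 2) (fun a => A.L a.1) (a, j, e) γ := by
  rw [mono, toModule_lof]

/-- The restriction to `t = s`, `dt = 0`: this is `evalAt`, with the index set of the direct sum
written out in its source. -/
def evalTensor (s : ℝ) : A.TensorTotal →ₗ[ℝ] A.Total := A.evalAt s

theorem evalTensor_lof (s : ℝ) (a : A.ι) (j : ℕ) (e : Fin 2) (γ : A.L a) :
    A.evalTensor s (lof ℝ (A.ι × ℕ × Fin 2) (fun a => A.L a.1) (a, j, e) γ) =
      if e = 0 then s ^ j • lof ℝ A.ι A.L a γ else 0 := by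
  refine (toModule_lof ℝ (M := fun a : A.ι × ℕ × Fin 2 => A.L a.1) (a, j, e) γ).trans ?_
  split_ifs <;> rfl

theorem integral_mono (j : ℕ) (e : Fin 2) (γ : A.Total) :
    A.integral (A.mono j e γ) = if e = 0 then 0 else ((j : ℝ) + 1)⁻¹ • γ := by
  induction γ using DirectSum.induction_on with
  | zero => simp
  | of a γ =>
    rw [← lof_eq_of ℝ, mono_lof, integral_lof]
  | add γ δ h1 h2 =>
    rw [map_add, map_add, h1, h2]
    split_ifs <;> simp

theorem evalTensor_mono (s : ℝ) (j : ℕ) (e : Fin 2) (γ : A.Total) :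
    A.evalTensor s (A.mono j e γ) = if e = 0 then s ^ j • γ else 0 := by
  induction γ using DirectSum.induction_on with
  | zero => simp
  | of a γ =>
    rw [← lof_eq_of ℝ, mono_lof, evalTensor_lof]
  | add γ δ h1 h2 =>
    rw [map_add, map_add, h1, h2]
    split_ifs <;> simp

theorem tensorDiff_lof (a : A.ι) (j : ℕ) (e : Fin 2) (γ : A.L a) :
    A.tensorDiff (lof ℝ (A.ι × ℕ × Fin 2) (fun a => A.L a.1) (a, j, e) γ) =
      A.mono j e (A.br 1 fun _ => lof ℝ A.ι A.L a γ) +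
        if e = 0 then ((-1 : ℝ) ^ A.deg a * j) •
          lof ℝ (A.ι × ℕ × Fin 2) (fun a => A.L a.1) (a, j - 1, 1) γ else 0 := by
  have h : Function.update (fun _ : Fin 1 => (0 : A.Total)) 0 (lof ℝ A.ι A.L a γ) =
      fun _ => lof ℝ A.ι A.L a γ := by
    funext i; rw [Subsingleton.elim i 0, Function.update_self]
  rw [tensorDiff, toModule_lof, LinearMap.add_apply]
  congr 1
  · change A.mono j e (A.br 1 (Function.update _ _ _)) = _
    rw [h]
  · simp only
    split_ifs <;> rfl

/-- The differential `l₁` as a linear map. -/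
def diff : A.Total →ₗ[ℝ] A.Total := (A.br 1).toLinearMap (fun _ => 0) 0

theorem diff_apply (γ : A.Total) : A.diff γ = A.br 1 fun _ => γ := by
  change A.br 1 (Function.update _ _ _) = _
  congr 1
  funext i; rw [Subsingleton.elim i 0, Function.update_self]

theorem lof_mem_homog {d : ℤ} {y : A.Total} (hy : y ∈ A.homog d) (a : A.ι) :
    A.deg a = d ∨ y a = 0 := by
  by_cases h : A.deg a = d
  · exact Or.inl h
  · exact Or.inr (hy a h)

/-- Induction on homogeneous elements. -/
theorem homog_induction {d : ℤ} {p : A.Total → Prop} (h0 : p 0)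
    (ha : ∀ a γ, A.deg a = d → p (lof ℝ A.ι A.L a γ)) (hadd : ∀ y z, p y → p z → p (y + z))
    {y : A.Total} (hy : y ∈ A.homog d) : p y := by
  classical
  rw [← DirectSum.sum_support_of y]
  refine Finset.sum_induction _ p hadd h0 fun a _ => ?_
  rcases A.lof_mem_homog hy a with h | h
  · exact ha a _ h
  · rw [h, map_zero]; exact h0

theorem tensorDiff_mono {d : ℤ} (j : ℕ) (e : Fin 2) {γ : A.Total} (hγ : γ ∈ A.homog d) :
    A.tensorDiff (A.mono j e γ) = A.mono j e (A.diff γ) +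
      if e = 0 then ((-1 : ℝ) ^ d * j) • A.mono (j - 1) 1 γ else 0 := by
  refine A.homog_induction (p := fun γ => A.tensorDiff (A.mono j e γ) = A.mono j e (A.diff γ) +
      if e = 0 then ((-1 : ℝ) ^ d * j) • A.mono (j - 1) 1 γ else 0) ?_ ?_ ?_ hγ
  · simp
  · rintro a γ rfl
    rw [mono_lof, mono_lof, tensorDiff_lof, diff_apply]
  · intro y z hy hz
    rw [map_add, map_add, hy, hz, map_add, map_add, map_add, smul_add]
    split_ifs <;> abel

/-- Induction on homogeneous elements of `A ⊗ Ω(ℝ)`. -/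
theorem tensor_homog_induction {d : ℤ} {p : A.TensorTotal → Prop} (h0 : p 0)
    (ha : ∀ a j e (γ : A.L a), A.deg a + ((e : Fin 2) : ℕ) = d →
      p (lof ℝ (A.ι × ℕ × Fin 2) (fun a => A.L a.1) (a, j, e) γ))
    (hadd : ∀ y z, p y → p z → p (y + z)) {y : A.TensorTotal}
    (hy : y ∈ A.tensorForms.homog d) : p y :=
  A.tensorForms.homog_induction h0 (fun a γ h => ha a.1 a.2.1 a.2.2 γ h) hadd hy

/-- Stokes' theorem on the interval `[0, 1]`. -/
theorem integral_tensorDiff {d : ℤ} {y : A.TensorTotal} (hy : y ∈ A.tensorForms.homog d) :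
    A.integral (A.tensorDiff y) = A.diff (A.integral y) +
      (-1 : ℝ) ^ d • (A.evalTensor 1 y - A.evalTensor 0 y) := by
  refine A.tensor_homog_induction (p := fun y => A.integral (A.tensorDiff y) =
    A.diff (A.integral y) + (-1 : ℝ) ^ d • (A.evalTensor 1 y - A.evalTensor 0 y)) ?_ ?_ ?_ hy
  · simp
  · rintro a j e γ hd
    rw [tensorDiff_lof, map_add, integral_mono, integral_lof, evalTensor_lof, evalTensor_lof,
      ← diff_apply]
    obtain rfl | rfl : e = 0 ∨ e = 1 := by omega
    · simp only [Fin.val_zero, Nat.cast_zero, add_zero] at hd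
      subst hd
      rw [if_pos rfl, if_pos rfl, if_pos rfl, if_pos rfl, if_pos rfl, map_smul, integral_lof,
        if_neg one_ne_zero, map_zero, smul_smul, zero_add, zero_add, one_pow, one_smul]
      cases j with
      | zero => simp
      | succ j =>
        have : (j : ℝ) + 1 ≠ 0 := by positivity
        rw [Nat.add_sub_cancel, Nat.cast_succ, mul_assoc, mul_inv_cancel₀ this, mul_one,
          zero_pow j.succ_ne_zero, zero_smul, sub_zero]
    · simp
  · intro y z h1 h2
    rw [map_add, map_add, h1, h2, map_add, map_add, map_add, map_add]
    module

theorem mono_mem_homog {d : ℤ} (j : ℕ) (e : Fin 2) {γ : A.Total} (hγ : γ ∈ A.homog d) :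
    (A.mono j e γ : A.TensorTotal) ∈ A.tensorForms.homog (d + (e : ℕ)) := by
  refine A.homog_induction (p := fun γ => (A.mono j e γ : A.TensorTotal) ∈
    A.tensorForms.homog (d + (e : ℕ))) ?_ ?_ ?_ hγ
  · rw [map_zero]; exact zero_mem _
  · rintro a γ rfl b hb
    rw [mono_lof]
    refine of_eq_of_ne (β := fun a : A.ι × ℕ × Fin 2 => A.L a.1) _ _ _ ?_
    rintro rfl
    exact hb rfl
  · intro y z hy hz
    rw [map_add]; exact add_mem hy hz

theorem integral_mem_homog {d : ℤ} {y : A.TensorTotal} (hy : y ∈ A.tensorForms.homog d) :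
    A.integral y ∈ A.homog (d - 1) := by
  refine A.tensor_homog_induction (p := fun y => A.integral y ∈ A.homog (d - 1)) ?_ ?_ ?_ hy
  · rw [map_zero]; exact zero_mem _
  · rintro a j e γ hd
    rw [integral_lof]
    split_ifs with he
    · exact zero_mem _
    · refine Submodule.smul_mem _ _ fun b hb => of_eq_of_ne _ _ _ ?_
      rintro rfl
      apply hb
      have : (e : ℕ) = 1 := by omega
      rw [this] at hd
      push_cast at hd
      omega
  · intro y z hy hz
    rw [map_add]; exact add_mem hy hz

theorem tensorBr_lof (k : ℕ) (p : Fin k → A.ι × ℕ × Fin 2) (γ : ∀ i, A.L (p i).1) :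
    A.tensorBr k (fun i => lof ℝ (A.ι × ℕ × Fin 2) (fun a => A.L a.1) (p i) (γ i)) =
      if h : ∑ i, ((p i).2.2 : ℕ) < 2 then
        (∏ l, ∏ i with i < l, (-1 : ℝ) ^ (((p i).2.2 : ℕ) * A.deg (p l).1)) •
          A.mono (∑ i, (p i).2.1) ⟨∑ i, ((p i).2.2 : ℕ), h⟩
            (A.br k fun i => lof ℝ A.ι A.L (p i).1 (γ i))
      else 0 := by
  rw [tensorBr, MultilinearMap.fromDirectSumEquiv_lof]
  split_ifs <;> rfl

/-- Subspaces `N a` of the summands of `A` such that the higher brackets vanish as soon as one of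
the arguments lies in one of them. -/
def IsNull (N : ∀ a, Submodule ℝ (A.L a)) : Prop :=
  ∀ (k : ℕ), 2 ≤ k → ∀ (p : Fin k → A.ι) (γ : ∀ i, A.L (p i)), (∃ i, γ i ∈ N (p i)) →
    A.br k (fun i => lof ℝ A.ι A.L (p i) (γ i)) = 0

variable {A} {N : ∀ a, Submodule ℝ (A.L a)}

theorem IsNull.br_eq_zero (hN : A.IsNull N) {k : ℕ} (hk : 2 ≤ k) (z : Fin k → A.Total)
    (h : ∃ i, ∀ a, z i a ∈ N a) : A.br k z = 0 := by
  refine multilinearMap_eq_zero_of_components _ _ fun p => hN k hk p _ ?_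
  obtain ⟨i, hi⟩ := h
  exact ⟨i, hi _⟩

theorem IsNull.tensorBr_eq_zero (hN : A.IsNull N) {k : ℕ} (hk : 2 ≤ k)
    (z : Fin k → A.TensorTotal) (h : ∃ i, ∀ a, z i a ∈ N a.1) : A.tensorBr k z = 0 := by
  refine multilinearMap_eq_zero_of_components _ _ fun p => ?_
  obtain ⟨i, hi⟩ := h
  rw [tensorBr_lof, hN k hk _ _ ⟨i, hi _⟩]
  split_ifs <;> simp

/-- The brackets of elements whose `dt`-part is null have no `dt`-part. -/
theorem IsNull.integral_tensorBr (hN : A.IsNull N) {k : ℕ} (hk : 2 ≤ k)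
    (z : Fin k → A.TensorTotal) (h : ∀ i a j, z i (a, j, 1) ∈ N a) :
    A.integral (A.tensorBr k z) = 0 := by
  change (A.integral.compMultilinearMap (A.tensorBr k)) z = 0
  refine multilinearMap_eq_zero_of_components _ _ fun p => ?_
  rw [LinearMap.compMultilinearMap_apply, tensorBr_lof]
  by_cases h0 : ∃ i, (p i).2.2 = 1
  · obtain ⟨i, hi⟩ := h0
    have : z i (p i) ∈ N (p i).1 := by
      generalize p i = q at hi
      obtain ⟨a, j, e⟩ := q
      change e = 1 at hi
      subst hi
      exact h i a j
    rw [hN k hk _ _ ⟨i, this⟩]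
    split_ifs <;> simp
  · have h1 (i : Fin k) : (p i).2.2 = 0 := by
      by_contra h2
      exact h0 ⟨i, by omega⟩
    split_ifs with h2
    · rw [map_smul, integral_mono, if_pos (by simp [h1]), smul_zero]
    · exact map_zero _

theorem tensorBr_mono_zero (k : ℕ) (z : Fin k → A.Total) :
    A.tensorBr k (fun i => A.mono 0 0 (z i)) = A.mono 0 0 (A.br k z) := by
  rw [← sub_eq_zero]
  change ((A.tensorBr k).compLinearMap (fun _ => A.mono 0 0) -
    (A.mono 0 0).compMultilinearMap (A.br k)) z = 0
  refine multilinearMap_eq_zero_of_components _ _ fun p => ?_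
  rw [_root_.sub_apply, sub_eq_zero, MultilinearMap.compLinearMap_apply,
    LinearMap.compMultilinearMap_apply]
  simp only [mono_lof]
  rw [tensorBr_lof A k (fun i => (p i, 0, 0)) (fun i => z i (p i)), dif_pos (by simp)]
  simp

end LInftyData

end Tensor

/-! ### The two sides of the equation for morphisms -/

section Sides

open DirectSum
variable {A B : LInftyData} {V W : Type*} [AddCommGroup V] [Module ℝ V]
  [AddCommGroup W] [Module ℝ W]

open Finset in
open Classical in
/-- The left hand side of the equation for `L_∞`-morphisms, for an arbitrary family `g` of
multilinear maps. -/
def bracketSide (g : ∀ k : ℕ, MultilinearMap ℝ (fun _ : Fin k => A.Total) W) (m : ℕ)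
    (d : Fin m → ℤ) (x : Fin m → A.Total) : W :=
  ∑ I : Finset (Fin m) with I.Nonempty, unshuffleSign d I •
    shifted (g (Iᶜ.card + 1)) (Fin.cons (∑ i ∈ I, d i + 2 - I.card) (subTuple d Iᶜ))
      (Fin.cons (shifted (A.br I.card) (subTuple d I) (subTuple x I)) (subTuple x Iᶜ))

open Finset in
open Classical in
/-- The part of the right hand side of the equation for `L_∞`-morphisms which involves the bracket
`l_r` of the target, for an arbitrary family `g` of multilinear maps. -/
def blockSide (g : ∀ k : ℕ, MultilinearMap ℝ (fun _ : Fin k => A.Total) B.Total) (m : ℕ)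
    (d : Fin m → ℤ) (x : Fin m → A.Total) (r : ℕ) : B.Total :=
  (r.factorial : ℝ)⁻¹ • ∑ p : Fin m → Fin r with Function.Surjective p, blockSign d p •
    shifted (B.br r) (fun b => ∑ i ∈ block p b, d i + 1 - (block p b).card)
      (fun b => shifted (g (block p b).card) (subTuple d (block p b)) (subTuple x (block p b)))

theorem LInftyHom.bracketSide_eq (f : LInftyHom A B) {m : ℕ} {d : Fin m → ℤ}
    {x : Fin m → A.Total} (hm : 1 ≤ m) (hx : ∀ i, x i ∈ A.homog (d i)) :
    bracketSide f.comp m d x = ∑ r ∈ Finset.Icc 1 m, blockSide f.comp m d x r :=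
  f.eqn m d x hm hx

theorem shifted_eq_zero {k : ℕ} (g : MultilinearMap ℝ (fun _ : Fin k => V) W) (d : Fin k → ℤ)
    {x : Fin k → V} (i : Fin k) (h : x i = 0) : shifted g d x = 0 := by
  rw [shifted, g.map_coord_zero i h, smul_zero]

theorem shifted_zero_deg {k : ℕ} (g : MultilinearMap ℝ (fun _ : Fin k => V) W)
    (x : Fin k → V) : shifted g (fun _ => 0) x = g x := by
  simp [shifted]

theorem subTuple_eq_zero {m : ℕ} {X : Type*} [Zero X] {x : Fin m → X} {i : Fin m} (h : x i = 0)
    {S : Finset (Fin m)} (hi : i ∈ S) : ∃ j, subTuple x S j = 0 := by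
  have : i ∈ Set.range (S.orderEmbOfFin rfl) := by simpa using hi
  obtain ⟨j, rfl⟩ := this
  exact ⟨j, h⟩

theorem bracketSide_eq_zero (g : ∀ k : ℕ, MultilinearMap ℝ (fun _ : Fin k => A.Total) W) {m : ℕ}
    (d : Fin m → ℤ) {x : Fin m → A.Total} {i : Fin m} (h : x i = 0) :
    bracketSide g m d x = 0 := by
  classical
  refine Finset.sum_eq_zero fun I _ => ?_
  by_cases hi : i ∈ I
  · obtain ⟨j, hj⟩ := subTuple_eq_zero h hi
    rw [shifted_eq_zero _ _ 0, smul_zero]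
    rw [Fin.cons_zero, shifted_eq_zero _ _ j hj]
  · obtain ⟨j, hj⟩ := subTuple_eq_zero h (Finset.mem_compl.2 hi)
    rw [shifted_eq_zero _ _ j.succ, smul_zero]
    rw [Fin.cons_succ, hj]

theorem blockSide_eq_zero (g : ∀ k : ℕ, MultilinearMap ℝ (fun _ : Fin k => A.Total) B.Total)
    {m : ℕ} (d : Fin m → ℤ) {x : Fin m → A.Total} {i : Fin m} (h : x i = 0) (r : ℕ) :
    blockSide g m d x r = 0 := by
  classical
  rw [blockSide, Finset.sum_eq_zero, smul_zero]
  intro p _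
  obtain ⟨j, hj⟩ := subTuple_eq_zero h (S := block p (p i)) (by simp [block])
  rw [shifted_eq_zero _ _ (p i), smul_zero]
  rw [shifted_eq_zero _ _ j hj]

theorem map_comp_orderEmbOfFin (g : ∀ k : ℕ, MultilinearMap ℝ (fun _ : Fin k => V) W) {m k : ℕ}
    (x : Fin m → V) {S : Finset (Fin m)} (h : S.card = k) :
    g S.card (subTuple x S) = g k (x ∘ S.orderEmbOfFin h) := by
  subst h; rfl

/-- The summand `r = 1` is the differential of the target applied to the top component. -/
theorem blockSide_one (g : ∀ k : ℕ, MultilinearMap ℝ (fun _ : Fin k => A.Total) B.Total) {m : ℕ}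
    (hm : 1 ≤ m) (x : Fin m → A.Total) : blockSide g m (fun _ => 0) x 1 = B.diff (g m x) := by
  classical
  have hp (p : Fin m → Fin 1) (b : Fin 1) : block p b = Finset.univ := by
    ext i; simp [block, Subsingleton.elim (p i) b]
  have hs (p : Fin m → Fin 1) : Function.Surjective p := fun b =>
    ⟨⟨0, hm⟩, Subsingleton.elim _ _⟩
  have h1 (S : Finset (Fin m)) (hS : S = Finset.univ) :
      shifted (g S.card) (subTuple (fun _ => 0) S) (subTuple x S) = g m x := by
    subst hS
    have hc : (Finset.univ : Finset (Fin m)).card = m := by simp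
    refine (shifted_zero_deg (g _) _).trans ?_
    rw [map_comp_orderEmbOfFin g x hc, ← Finset.orderEmbOfFin_unique hc (f := id) (by simp)
      strictMono_id, Function.comp_id]
  rw [blockSide, Finset.filter_true_of_mem fun p _ => hs p, Fintype.sum_unique]
  have h2 (b : Fin 1) := h1 _ (hp default b)
  simp only [h2]
  have h3 : blockSign (fun _ => 0) (default : Fin m → Fin 1) = 1 := by
    refine Finset.prod_eq_one fun j _ => ?_
    rw [Finset.filter_false_of_mem, Finset.prod_empty]
    intro i _ h
    exact absurd h.2 (by simp [Subsingleton.elim ((default : Fin m → Fin 1) j)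
      ((default : Fin m → Fin 1) i)])
  rw [h3, one_smul, LInftyData.diff_apply]
  simp [shifted]

theorem shifted_block {m r : ℕ} (g : ∀ k : ℕ, MultilinearMap ℝ (fun _ : Fin k => V) W)
    (p : Fin m → Fin r) (x : Fin m → V) :
    (fun b => shifted (g (block p b).card) (subTuple (fun _ => 0) (block p b))
      (subTuple x (block p b))) = fun b => g (block p b).card (subTuple x (block p b)) :=
  funext fun _ => shifted_zero_deg _ _

/-- A comparison of the brackets of two families, after linear maps `T` and `S`, gives a comparison
of the corresponding sides. -/
theorem blockSide_congr {C : LInftyData}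
    (g : ∀ k : ℕ, MultilinearMap ℝ (fun _ : Fin k => A.Total) B.Total)
    (h : ∀ k : ℕ, MultilinearMap ℝ (fun _ : Fin k => A.Total) C.Total)
    (T : B.Total →ₗ[ℝ] W) (S : C.Total →ₗ[ℝ] W) {m r : ℕ} (x : Fin m → A.Total)
    (H : ∀ (k : Fin r → ℕ) (y : ∀ b, Fin (k b) → A.Total), (∀ b, 1 ≤ k b) →
      T (B.br r fun b => g (k b) (y b)) = S (C.br r fun b => h (k b) (y b))) :
    T (blockSide g m (fun _ => 0) x r) = S (blockSide h m (fun _ => 0) x r) := by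
  rw [blockSide, blockSide, map_smul, map_smul, map_sum, map_sum]
  congr 1
  refine Finset.sum_congr rfl fun p hp => ?_
  rw [map_smul, map_smul]
  congr 1
  rw [shifted_block g, shifted_block h, shifted, shifted, map_smul, map_smul]
  congr 1
  refine H _ _ fun b => ?_
  obtain ⟨i, hi⟩ := (Finset.mem_filter.1 hp).2 b
  exact Finset.card_pos.2 ⟨i, by simp [block, hi]⟩

theorem bracketSide_comp (T : V →ₗ[ℝ] W)
    (g : ∀ k : ℕ, MultilinearMap ℝ (fun _ : Fin k => A.Total) V) (m : ℕ)
    (d : Fin m → ℤ) (x : Fin m → A.Total) :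
    bracketSide (fun k => T.compMultilinearMap (g k)) m d x = T (bracketSide g m d x) := by
  simp only [bracketSide, map_sum, map_smul, shifted, LinearMap.compMultilinearMap_apply]

theorem bracketSide_add (g h : ∀ k : ℕ, MultilinearMap ℝ (fun _ : Fin k => A.Total) W) (m : ℕ)
    (d : Fin m → ℤ) (x : Fin m → A.Total) :
    bracketSide (fun k => g k + h k) m d x = bracketSide g m d x + bracketSide h m d x := by
  simp only [bracketSide, shifted, _root_.add_apply, smul_add, Finset.sum_add_distrib]

theorem bracketSide_sub (g h : ∀ k : ℕ, MultilinearMap ℝ (fun _ : Fin k => A.Total) W) (m : ℕ)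
    (d : Fin m → ℤ) (x : Fin m → A.Total) :
    bracketSide (fun k => g k - h k) m d x = bracketSide g m d x - bracketSide h m d x := by
  simp only [bracketSide, shifted, _root_.sub_apply, smul_sub, Finset.sum_sub_distrib]

end Sides

/-! ### Morphisms out of a Lie algebra -/

section LieSource

open DirectSum
variable {𝔤 : Type*} [LieRing 𝔤] [LieAlgebra ℝ 𝔤] {B : LInftyData}
  {V W : Type*} [AddCommGroup V] [Module ℝ V] [AddCommGroup W] [Module ℝ W]

/-- The inclusion of a Lie algebra in the total space of its `L_∞`-algebra. -/
def ofLie : 𝔤 →ₗ[ℝ] (lieData 𝔤).Total := lof ℝ Unit (fun _ => 𝔤) ()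

/-- The inverse of `ofLie`. -/
def toLie : (lieData 𝔤).Total →ₗ[ℝ] 𝔤 := DirectSum.component ℝ Unit (fun _ => 𝔤) ()

theorem toLie_ofLie (x : 𝔤) : toLie (ofLie x) = x :=
  DirectSum.component.lof_self ℝ (M := fun _ : Unit => 𝔤) () x

theorem ofLie_toLie (x : (lieData 𝔤).Total) : ofLie (toLie x) = x := by
  refine DFinsupp.ext fun a => ?_
  exact toLie_ofLie (toLie x)

theorem mem_homog_zero (x : (lieData 𝔤).Total) : x ∈ (lieData 𝔤).homog 0 :=
  fun _ h => absurd rfl h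

theorem eq_zero_of_mem_homog {d : ℤ} (hd : d ≠ 0) {x : (lieData 𝔤).Total}
    (h : x ∈ (lieData 𝔤).homog d) : x = 0 :=
  DFinsupp.ext fun a => h a hd.symm

theorem lieData_br_two (x : Fin 2 → 𝔤) :
    (lieData 𝔤).br 2 (fun i => ofLie (x i)) = ofLie ⁅x 0, x 1⁆ := by
  change ofLie ⁅toLie (ofLie (x 0)), toLie (ofLie (x 1))⁆ = _
  rw [toLie_ofLie, toLie_ofLie]

theorem lieData_br_of_ne {k : ℕ} (hk : k ≠ 2) : (lieData 𝔤).br k = 0 := by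
  match k, hk with
  | 0, _ => rfl
  | 1, _ => rfl
  | k + 3, _ => rfl

/-- The summand of `bracketSide` which belongs to the pair of positions `i < j + 1`. -/
theorem bracketSide_pair (g : ∀ k : ℕ, MultilinearMap ℝ (fun _ : Fin k => (lieData 𝔤).Total) W)
    {k : ℕ} (x : Fin (k + 2) → 𝔤) {i j : Fin (k + 1)} (hij : i ≤ j) (I : Finset (Fin (k + 2)))
    (hI : I = {i.castSucc, j.succ}) :
    unshuffleSign (fun _ => 0) I • shifted (g (Iᶜ.card + 1))
        (Fin.cons (∑ _i ∈ I, 0 + 2 - I.card) (subTuple (fun _ => 0) Iᶜ))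
        (Fin.cons (shifted ((lieData 𝔤).br I.card) (subTuple (fun _ => 0) I)
          (subTuple (fun i => ofLie (x i)) I)) (subTuple (fun i => ofLie (x i)) Iᶜ)) =
      (-1 : ℝ) ^ ((i : ℕ) + j) • g (k + 1)
        (fun l => ofLie ((Fin.cons ⁅x i.castSucc, x j.succ⁆
          (j.removeNth (i.castSucc.removeNth x)) : Fin (k + 1) → 𝔤) l)) := by
  have hlt : i.castSucc < j.succ := Fin.castSucc_lt_succ_iff.2 hij
  have hc : I.card = 2 := by rw [hI]; exact Finset.card_pair hlt.ne
  have hcc : Iᶜ.card = k := by rw [Finset.card_compl, hc]; simp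
  -- Moving `x i` to the front passes `i` arguments, and then `x (j + 1)` passes `j` of them, since
  -- `x i` is gone; all of them are odd in the shifted grading.
  have hsign : unshuffleSign (fun _ => 0) I = (-1 : ℝ) ^ ((i : ℕ) + j) := by
    rw [unshuffleSign, hI, Finset.prod_pair hlt.ne]
    simp only [Finset.prod_const]
    have h1 : (Finset.filter (· < i.castSucc) ({i.castSucc, j.succ} : Finset (Fin (k + 2)))ᶜ) =
        Finset.Iio i.castSucc := by
      ext l
      simp only [Finset.mem_filter, Finset.mem_compl, Finset.mem_insert, Finset.mem_singleton,
        Finset.mem_Iio]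
      constructor
      · exact fun h => h.2
      · exact fun h => ⟨fun h' => by rcases h' with rfl | rfl <;> order, h⟩
    have h2 : (Finset.filter (· < j.succ) ({i.castSucc, j.succ} : Finset (Fin (k + 2)))ᶜ) =
        (Finset.Iio j.succ).erase i.castSucc := by
      ext l
      simp only [Finset.mem_filter, Finset.mem_compl, Finset.mem_insert, Finset.mem_singleton,
        Finset.mem_Iio, Finset.mem_erase]
      constructor
      · exact fun h => ⟨fun h' => h.1 (Or.inl h'), h.2⟩
      · exact fun h => ⟨fun h' => by rcases h' with h' | rfl; exacts [h.1 h', lt_irrefl _ h.2], h.2⟩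
    rw [h1, h2, Finset.card_erase_of_mem (Finset.mem_Iio.2 hlt), Fin.card_Iio, Fin.card_Iio]
    simp [pow_add]
  have h2 : subTuple (fun i => ofLie (x i)) I = fun l => ofLie (subTuple x I l) := rfl
  have h3 : shifted ((lieData 𝔤).br I.card) (subTuple (fun _ => 0) I)
      (subTuple (fun i => ofLie (x i)) I) = ofLie ⁅x i.castSucc, x j.succ⁆ := by
    refine (shifted_zero_deg _ _).trans ?_
    rw [map_comp_orderEmbOfFin (lieData 𝔤).br (fun i => ofLie (x i)) hc]
    have : ![i.castSucc, j.succ] = I.orderEmbOfFin hc := by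
      refine Finset.orderEmbOfFin_unique hc (fun l => ?_) ?_
      · rw [hI]; fin_cases l <;> simp
      · intro a b hab
        fin_cases a <;> fin_cases b <;> simp_all
    rw [← this]
    exact lieData_br_two (fun l => x (![i.castSucc, j.succ] l))
  rw [h3, hsign]
  congr 1
  have h4 : (Fin.cons (∑ i ∈ I, 0 + 2 - (I.card : ℤ)) (subTuple (fun _ => (0 : ℤ)) Iᶜ)) =
      fun _ : Fin (Iᶜ.card + 1) => (0 : ℤ) := by
    funext l
    refine Fin.cases ?_ (fun l => rfl) l
    rw [Fin.cons_zero, hc]; simp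
  rw [h4, shifted_zero_deg]
  have h5 : (fun l => i.castSucc.succAbove (j.succAbove l)) = Iᶜ.orderEmbOfFin hcc := by
    refine Finset.orderEmbOfFin_unique hcc (fun l => ?_) ?_
    · rw [hI, Finset.mem_compl, Finset.mem_insert, Finset.mem_singleton, not_or]
      refine ⟨Fin.succAbove_ne _ _, fun h => ?_⟩
      rw [← Fin.succAbove_castSucc_of_le i j hij] at h
      exact Fin.succAbove_ne _ _ (Fin.succAbove_right_injective h)
    · exact (Fin.strictMono_succAbove _).comp (Fin.strictMono_succAbove _)
  have h6 (l : ℕ) (S : Finset (Fin (k + 2))) (hS : S.card = l) (a : (lieData 𝔤).Total)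
      (y : Fin (k + 2) → (lieData 𝔤).Total) : g (S.card + 1) (Fin.cons a (subTuple y S)) =
        g (l + 1) (Fin.cons a (y ∘ S.orderEmbOfFin hS)) := by
    subst hS; rfl
  rw [h6 k _ hcc, ← h5]
  congr 1
  funext l
  refine Fin.cases rfl (fun l => rfl) l

/-- For a Lie algebra, the left hand side of the equation for `L_∞`-morphisms is minus the
Chevalley-Eilenberg differential: only subsets with two elements contribute. -/
theorem bracketSide_lie (g : ∀ k : ℕ, MultilinearMap ℝ (fun _ : Fin k => (lieData 𝔤).Total) W)
    (k : ℕ) (x : Fin (k + 2) → 𝔤) :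
    bracketSide g (k + 2) (fun _ => 0) (fun i => ofLie (x i)) =
      ∑ i : Fin (k + 1), ∑ j ∈ Finset.Ici i, (-1 : ℝ) ^ ((i : ℕ) + j) • g (k + 1)
        (fun l => ofLie ((Fin.cons ⁅x i.castSucc, x j.succ⁆
          (j.removeNth (i.castSucc.removeNth x)) : Fin (k + 1) → 𝔤) l)) := by
  classical
  rw [Finset.sum_sigma' Finset.univ (fun i => Finset.Ici i)]
  symm
  refine Finset.sum_of_injOn (fun a => ({a.1.castSucc, a.2.succ} : Finset (Fin (k + 2))))
    ?_ ?_ ?_ ?_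
  · rintro ⟨i, j⟩ h ⟨i', j'⟩ h' e
    simp only [Finset.coe_sigma, Finset.coe_univ, Set.mem_sigma_iff, Set.mem_univ, true_and,
      Finset.coe_Ici, Set.mem_Ici] at h h'
    have e1 : i.castSucc ∈ ({i'.castSucc, j'.succ} : Finset (Fin (k + 2))) := by
      simp only at e; rw [← e]; simp
    have e2 : j.succ ∈ ({i'.castSucc, j'.succ} : Finset (Fin (k + 2))) := by
      simp only at e; rw [← e]; simp
    have e3 : i'.castSucc ∈ ({i.castSucc, j.succ} : Finset (Fin (k + 2))) := by
      simp only at e; rw [e]; simp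
    simp only [Finset.mem_insert, Finset.mem_singleton, Fin.ext_iff, Fin.val_castSucc,
      Fin.val_succ, Fin.le_def] at e1 e2 e3 h h'
    obtain rfl : i = i' := by ext; omega
    obtain rfl : j = j' := by ext; omega
    rfl
  · intro a _
    simp
  · intro I _ hI
    have hc : I.card ≠ 2 := by
      intro hc
      apply hI
      obtain ⟨a, b, h, rfl⟩ : ∃ a b, a < b ∧ I = {a, b} := by
        obtain ⟨a, b, hab, rfl⟩ := Finset.card_eq_two.1 hc
        rcases hab.lt_or_gt with h | h
        · exact ⟨a, b, h, rfl⟩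
        · exact ⟨b, a, h, Finset.pair_comm a b⟩
      refine ⟨⟨⟨a, ?_⟩, ⟨b - 1, ?_⟩⟩, ?_, ?_⟩
      · omega
      · omega
      · simp only [Finset.coe_sigma, Finset.coe_univ, Set.mem_sigma_iff, Set.mem_univ, true_and,
          Finset.coe_Ici, Set.mem_Ici, Fin.le_def]
        omega
      · have h1 : (⟨a, by omega⟩ : Fin (k + 1)).castSucc = a := rfl
        have h2 : (⟨b - 1, by omega⟩ : Fin (k + 1)).succ = b := by
          ext; simp only [Fin.succ_mk]; omega
        simp only [h1, h2]
    rw [lieData_br_of_ne hc, shifted_eq_zero _ _ 0, smul_zero]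
    rw [Fin.cons_zero, shifted, _root_.zero_apply, smul_zero]
  · rintro ⟨i, j⟩ h
    exact (bracketSide_pair g x (by simpa using h) _ rfl).symm

theorem bracketSide_lie_one
    (g : ∀ k : ℕ, MultilinearMap ℝ (fun _ : Fin k => (lieData 𝔤).Total) W)
    (d : Fin 1 → ℤ) (x : Fin 1 → (lieData 𝔤).Total) : bracketSide g 1 d x = 0 := by
  classical
  refine Finset.sum_eq_zero fun I _ => ?_
  have hc : I.card ≠ 2 := by
    have := I.card_le_univ
    simp only [Fintype.card_fin] at this
    omega
  rw [lieData_br_of_ne hc, shifted_eq_zero _ _ 0, smul_zero]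
  rw [Fin.cons_zero, shifted, _root_.zero_apply, smul_zero]

/-- An `L_∞`-morphism with source a Lie algebra, from the axioms on elements of degree `0`: every
other homogeneous element is zero. -/
def lieHom (g : ∀ k : ℕ, MultilinearMap ℝ (fun _ : Fin k => (lieData 𝔤).Total) B.Total)
    (degree : ∀ (k : ℕ) x, 1 ≤ k → g k x ∈ B.homog (1 - k))
    (skew : ∀ (k : ℕ) x, ∀ i j : Fin k, (i : ℕ) + 1 = j → g k (x ∘ Equiv.swap i j) = -g k x)
    (eqn : ∀ (m : ℕ) (x : Fin m → (lieData 𝔤).Total), 1 ≤ m → bracketSide g m (fun _ => 0) x =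
      ∑ r ∈ Finset.Icc 1 m, blockSide g m (fun _ => 0) x r) :
    LInftyHom (lieData 𝔤) B where
  comp := g
  degree k d x hk hx := by
    by_cases hd : ∃ i, d i ≠ 0
    · obtain ⟨i, hi⟩ := hd
      rw [(g k).map_coord_zero i (eq_zero_of_mem_homog hi (hx i))]
      exact zero_mem _
    · push Not at hd
      simpa [hd] using degree k x hk
  skew k d x hx i j hij := by
    rw [skew k x i j hij]
    by_cases hd : ∃ i, d i ≠ 0
    · obtain ⟨i, hi⟩ := hd
      rw [(g k).map_coord_zero i (eq_zero_of_mem_homog hi (hx i))]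
      simp
    · push Not at hd
      simp [hd]
  eqn m d x hm hx := by
    change bracketSide g m d x = ∑ r ∈ Finset.Icc 1 m, blockSide g m d x r
    by_cases hd : ∃ i, d i ≠ 0
    · obtain ⟨i, hi⟩ := hd
      have h0 := eq_zero_of_mem_homog hi (hx i)
      rw [bracketSide_eq_zero g d h0, Finset.sum_eq_zero]
      exact fun r _ => blockSide_eq_zero g d h0 r
    · push Not at hd
      obtain rfl : d = fun _ => 0 := funext hd
      exact eqn m x hm

end LieSource

/-! ### Homotopies and primitives -/

section Homotopies

open DirectSum LInftyData
variable {𝔤 : Type*} [LieRing 𝔤] [LieAlgebra ℝ 𝔤] {B : LInftyData} {N : ∀ a, Submodule ℝ (B.L a)}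

/-- The elements of a direct sum whose components lie in given submodules. -/
def componentwise {κ : Type*} {L : κ → Type*} [∀ a, AddCommGroup (L a)] [∀ a, Module ℝ (L a)]
    (N : ∀ a, Submodule ℝ (L a)) : Submodule ℝ (⨁ a, L a) where
  carrier := {y | ∀ a, y a ∈ N a}
  zero_mem' := fun _ => zero_mem _
  add_mem' := fun hy hz a => add_mem (hy a) (hz a)
  smul_mem' := fun c _ hy a => Submodule.smul_mem _ c (hy a)

theorem LInftyData.mono_apply_mem (j : ℕ) (e : Fin 2) {γ : B.Total} (hγ : ∀ a, γ a ∈ N a)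
    (c : B.ι × ℕ × Fin 2) : B.mono j e γ c ∈ N c.1 := by
  classical
  rw [← DirectSum.sum_support_of γ, map_sum, DFinsupp.finsetSum_apply]
  refine sum_mem fun a _ => ?_
  rw [← lof_eq_of ℝ, mono_lof]
  by_cases h : (a, j, e) = c
  · subst h
    rw [lof_apply]
    exact hγ a
  · rw [lof_eq_of, of_eq_of_ne _ _ _ (Ne.symm h)]
    exact zero_mem _

theorem LInftyData.tensorForms_diff (y : B.TensorTotal) :
    B.tensorForms.diff y = B.tensorDiff y :=
  B.tensorForms.diff_apply y

theorem LInftyHom.degree_lie (f : LInftyHom (lieData 𝔤) B) {k : ℕ} (hk : 1 ≤ k)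
    (x : Fin k → (lieData 𝔤).Total) : f.comp k x ∈ B.homog (1 - k) := by
  simpa using f.degree k (fun _ => 0) x hk fun i => mem_homog_zero _

theorem LInftyHom.skew_lie (f : LInftyHom (lieData 𝔤) B) {k : ℕ}
    (x : Fin k → (lieData 𝔤).Total) (i j : Fin k) (hij : (i : ℕ) + 1 = j) :
    f.comp k (x ∘ Equiv.swap i j) = -f.comp k x := by
  simpa using f.skew k (fun _ => 0) x (fun i => mem_homog_zero _) i j hij

theorem LInftyHom.bracketSide_eq_lie (f : LInftyHom (lieData 𝔤) B) {m : ℕ} (hm : 1 ≤ m)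
    (x : Fin m → (lieData 𝔤).Total) :
    bracketSide f.comp m (fun _ => 0) x = B.diff (f.comp m x) +
      ∑ r ∈ Finset.Icc 2 m, blockSide f.comp m (fun _ => 0) x r := by
  rw [f.bracketSide_eq hm fun i => mem_homog_zero _, ← Finset.add_sum_Ioc_eq_sum_Icc hm,
    blockSide_one _ hm]
  rfl

/-- The linear equation `-(d_𝔤 b)_m = l₁ b_m + (-1)^m (f_m - f'_m)`, which relates the integral `b`
of the `dt`-part of a homotopy from `f` to `f'` to its ends. -/
def IsPrimitive (f f' : LInftyHom (lieData 𝔤) B)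
    (b : ∀ k : ℕ, MultilinearMap ℝ (fun _ : Fin k => (lieData 𝔤).Total) B.Total) : Prop :=
  ∀ (m : ℕ) (x : Fin m → (lieData 𝔤).Total), 1 ≤ m → bracketSide b m (fun _ => 0) x =
    B.diff (b m x) + (-1 : ℝ) ^ m • (f.comp m x - f'.comp m x)

theorem neg_one_zpow_one_sub (m : ℕ) : (-1 : ℝ) ^ (1 - m : ℤ) = -(-1) ^ m := by
  rw [zpow_sub₀ (by norm_num), zpow_one, zpow_natCast]
  rcases neg_one_pow_eq_or ℝ m with h | h <;> simp [h]

/-- Integrating the equation for a homotopy over `[0, 1]`: the higher brackets have no `dt`-part. -/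
theorem isPrimitive_integral (hN : B.IsNull N) (hneg : ∀ a, B.deg a < 0 → N a = ⊤)
    {f f' : LInftyHom (lieData 𝔤) B} (H : LInftyHom (lieData 𝔤) B.tensorForms)
    (h0 : ∀ k, 1 ≤ k → (B.evalAt 0).compMultilinearMap (H.comp k) = f.comp k)
    (h1 : ∀ k, 1 ≤ k → (B.evalAt 1).compMultilinearMap (H.comp k) = f'.comp k) :
    IsPrimitive f f' fun k => B.integral.compMultilinearMap (H.comp k) := by
  intro m x hm
  rw [bracketSide_comp (V := B.TensorTotal) B.integral H.comp]
  have e := congrArg B.integral (H.bracketSide_eq_lie hm x)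
  refine e.trans ?_
  have e2 : ∑ r ∈ Finset.Icc 2 m, B.integral (blockSide H.comp m (fun _ => 0) x r) = 0 := by
    refine Finset.sum_eq_zero fun r hr => ?_
    have hr2 : 2 ≤ r := (Finset.mem_Icc.1 hr).1
    have := blockSide_congr H.comp H.comp B.integral 0 x (r := r) (m := m) ?_
    · exact this
    · intro k y hk
      rw [LinearMap.zero_apply]
      obtain ⟨r, rfl⟩ : ∃ s, r = s + 2 := ⟨r - 2, by omega⟩
      refine hN.integral_tensorBr hr2 _ fun i a j => ?_
      by_cases ha : B.deg a < 0
      · rw [hneg a ha]; trivial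
      · have h := H.degree_lie (hk i) (y i) (a, j, 1) (by
          change B.deg a + ((1 : ℕ) : ℤ) ≠ _
          have := hk i
          push_cast
          omega)
        exact (congrArg (· ∈ N a) h).mpr (zero_mem _)
  have e3 (u v : B.TensorTotal) : B.integral (u + v) = B.integral u + B.integral v := map_add _ _ _
  refine (e3 _ _).trans ?_
  have e4 : B.integral (∑ r ∈ Finset.Icc 2 m, blockSide H.comp m (fun _ => 0) x r : B.TensorTotal)
    = 0 := (map_sum B.integral _ _).trans e2
  have e5 : B.integral (B.tensorForms.diff (H.comp m x)) = B.diff (B.integral (H.comp m x)) +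
      (-1 : ℝ) ^ (1 - m : ℤ) • (f'.comp m x - f.comp m x) := by
    refine (congrArg B.integral (tensorForms_diff _)).trans ?_
    rw [← h0 m hm, ← h1 m hm]
    exact B.integral_tensorDiff (H.degree_lie hm x)
  refine (congrArg₂ (· + ·) e5 e4).trans ?_
  rw [neg_one_zpow_one_sub, add_zero]
  change _ = B.diff (B.integral (H.comp m x)) + _
  module

/-- The components `(1 - t) f + t f' + b dt`. -/
def homotopyComp (f f' : LInftyHom (lieData 𝔤) B)
    (b : ∀ k : ℕ, MultilinearMap ℝ (fun _ : Fin k => (lieData 𝔤).Total) B.Total) (k : ℕ) :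
    MultilinearMap ℝ (fun _ : Fin k => (lieData 𝔤).Total) B.TensorTotal :=
  (B.mono 0 0).compMultilinearMap (f.comp k) +
    (B.mono 1 0).compMultilinearMap (f'.comp k - f.comp k) +
    (B.mono 0 1).compMultilinearMap (b k)

theorem homotopyComp_apply (f f' : LInftyHom (lieData 𝔤) B)
    (b : ∀ k : ℕ, MultilinearMap ℝ (fun _ : Fin k => (lieData 𝔤).Total) B.Total) (k : ℕ)
    (x : Fin k → (lieData 𝔤).Total) : homotopyComp f f' b k x = B.mono 0 0 (f.comp k x) +
      B.mono 1 0 (f'.comp k x - f.comp k x) + B.mono 0 1 (b k x) := rfl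

theorem evalTensor_homotopyComp (f f' : LInftyHom (lieData 𝔤) B)
    (b : ∀ k : ℕ, MultilinearMap ℝ (fun _ : Fin k => (lieData 𝔤).Total) B.Total) (k : ℕ)
    (x : Fin k → (lieData 𝔤).Total) (s : ℝ) : B.evalTensor s (homotopyComp f f' b k x) =
      f.comp k x + s • (f'.comp k x - f.comp k x) := by
  rw [homotopyComp_apply, map_add, map_add, evalTensor_mono, evalTensor_mono, evalTensor_mono]
  simp

/-- Conversely, a primitive gives rise to an affine homotopy, since null terms do not contribute
to the higher brackets. -/
theorem equivalent_of_isPrimitive (hN : B.IsNull N) (hneg : ∀ a, B.deg a < 0 → N a = ⊤)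
    {f f' : LInftyHom (lieData 𝔤) B}
    (hff' : ∀ k x, 1 ≤ k → ∀ a, (f'.comp k x - f.comp k x) a ∈ N a)
    {b : ∀ k : ℕ, MultilinearMap ℝ (fun _ : Fin k => (lieData 𝔤).Total) B.Total}
    (hdeg : ∀ (k : ℕ) x, 1 ≤ k → b k x ∈ B.homog (-k))
    (hskew : ∀ (k : ℕ) x, ∀ i j : Fin k, (i : ℕ) + 1 = j → b k (x ∘ Equiv.swap i j) = -b k x)
    (hb : IsPrimitive f f' b) : LInftyEquivalent f f' := by
  have hbN (k : ℕ) (hk : 1 ≤ k) (x) (a) : b k x a ∈ N a := by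
    by_cases ha : B.deg a < 0
    · rw [hneg a ha]; trivial
    · rw [hdeg k x hk a (by omega)]; exact zero_mem _
  -- The higher brackets of the homotopy are constant in `t` and have no `dt`-part.
  have hbr (r : ℕ) (hr : 2 ≤ r) (k : Fin r → ℕ) (hk : ∀ i, 1 ≤ k i)
      (y : ∀ i, Fin (k i) → (lieData 𝔤).Total) :
      B.tensorBr r (fun i => homotopyComp f f' b (k i) (y i)) =
        B.mono 0 0 (B.br r fun i => f.comp (k i) (y i)) := by
    rw [← tensorBr_mono_zero]
    refine multilinearMap_eq_of_sub_mem _ (componentwise fun a : B.ι × ℕ × Fin 2 => N a.1)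
      (fun z hz => hN.tensorBr_eq_zero hr z hz) fun i => ?_
    rw [homotopyComp_apply, add_assoc, add_sub_cancel_left]
    exact add_mem (mono_apply_mem 1 0 (hff' _ _ (hk i))) (mono_apply_mem 0 1 (hbN _ (hk i) _))
  have hbr' (r : ℕ) (hr : 2 ≤ r) (k : Fin r → ℕ) (hk : ∀ i, 1 ≤ k i)
      (y : ∀ i, Fin (k i) → (lieData 𝔤).Total) :
      B.br r (fun i => f'.comp (k i) (y i)) = B.br r fun i => f.comp (k i) (y i) := by
    exact multilinearMap_eq_of_sub_mem _ (componentwise N)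
      (fun z hz => hN.br_eq_zero hr z hz) fun i => hff' _ _ (hk i)
  refine ⟨lieHom (B := B.tensorForms) (homotopyComp f f' b) ?_ ?_ ?_, ?_⟩
  · intro k x hk
    have h1 := B.mono_mem_homog 0 0 (f.degree_lie hk x)
    have h2 := B.mono_mem_homog 1 0 (sub_mem (f'.degree_lie hk x) (f.degree_lie hk x))
    have h3 := B.mono_mem_homog 0 1 (hdeg k x hk)
    have e1 : (1 : ℤ) - k + ((0 : Fin 2) : ℕ) = 1 - k := by simp
    have e2 : -(k : ℤ) + ((1 : Fin 2) : ℕ) = 1 - k := by simp; ring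
    rw [e1] at h1 h2
    rw [e2] at h3
    exact add_mem (add_mem h1 h2) h3
  · intro k x i j hij
    change homotopyComp f f' b k _ = -homotopyComp f f' b k x
    rw [homotopyComp_apply, homotopyComp_apply, f.skew_lie x i j hij, f'.skew_lie x i j hij,
      hskew k x i j hij]
    simp only [map_neg, map_sub]
    abel
  · intro m x hm
    have hR : ∑ r ∈ Finset.Ioc 1 m,
        blockSide (B := B.tensorForms) (homotopyComp f f' b) m (fun _ => 0) x r =
        B.mono 0 0 (∑ r ∈ Finset.Icc 2 m, blockSide f.comp m (fun _ => 0) x r) := by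
      rw [map_sum]
      refine Finset.sum_congr rfl fun r hr => ?_
      obtain ⟨r, rfl⟩ : ∃ s, r = s + 2 := ⟨r - 2, by have := (Finset.mem_Ioc.1 hr).1; omega⟩
      exact blockSide_congr (B := B.tensorForms) (homotopyComp f f' b) f.comp LinearMap.id
        (B.mono 0 0) x fun k y hk => hbr (r + 2) (by omega) k hk y
    have hR' : ∑ r ∈ Finset.Icc 2 m, blockSide f'.comp m (fun _ => 0) x r =
        ∑ r ∈ Finset.Icc 2 m, blockSide f.comp m (fun _ => 0) x r := by
      refine Finset.sum_congr rfl fun r hr => ?_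
      exact blockSide_congr f'.comp f.comp LinearMap.id LinearMap.id x fun k y hk =>
        hbr' r (Finset.mem_Icc.1 hr).1 k hk y
    have h1 : blockSide (B := B.tensorForms) (homotopyComp f f' b) m (fun _ => 0) x 1 =
        B.tensorDiff (homotopyComp f f' b m x) :=
      (blockSide_one (B := B.tensorForms) (homotopyComp f f' b) hm x).trans (tensorForms_diff _)
    rw [← Finset.add_sum_Ioc_eq_sum_Icc hm]
    suffices h : bracketSide (W := B.TensorTotal) (homotopyComp f f' b) m (fun _ => 0) x =
        B.tensorDiff (homotopyComp f f' b m x) +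
          B.mono 0 0 (∑ r ∈ Finset.Icc 2 m, blockSide f.comp m (fun _ => 0) x r) from
      h.trans (congrArg₂ (· + ·) h1 hR).symm
    have hL : bracketSide (W := B.TensorTotal) (homotopyComp f f' b) m (fun _ => 0) x =
        B.mono 0 0 (bracketSide f.comp m (fun _ => 0) x) +
          B.mono 1 0 (bracketSide f'.comp m (fun _ => 0) x - bracketSide f.comp m (fun _ => 0) x) +
          B.mono 0 1 (bracketSide b m (fun _ => 0) x) := by
      rw [← bracketSide_sub, ← bracketSide_comp, ← bracketSide_comp, ← bracketSide_comp,
        ← bracketSide_add, ← bracketSide_add]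
      rfl
    refine hL.trans ?_
    rw [homotopyComp_apply, map_add, map_add, B.tensorDiff_mono 0 0 (f.degree_lie hm x),
      B.tensorDiff_mono 1 0 (sub_mem (f'.degree_lie hm x) (f.degree_lie hm x)),
      B.tensorDiff_mono 0 1 (hdeg m x hm), f.bracketSide_eq_lie hm, f'.bracketSide_eq_lie hm,
      hR', hb m x hm, neg_one_zpow_one_sub]
    simp only [map_add, map_sub, map_smul, Nat.cast_zero, Nat.cast_one, if_true, mul_zero, mul_one,
      zero_smul, one_ne_zero, if_false, tsub_self]
    module
  · intro k hk
    constructor <;> refine MultilinearMap.ext fun x => ?_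
    · refine (evalTensor_homotopyComp f f' b k x 0).trans ?_
      module
    · refine (evalTensor_homotopyComp f f' b k x 1).trans ?_
      module

end Homotopies

/-! ### The sign `ς(k)` -/

section Signs

theorem vs_mul_self (k : ℕ) : vs k * vs k = 1 := by
  rw [vs, neg_mul_neg, ← pow_add, ← two_mul, pow_mul]
  simp

theorem vs_smul_vs_smul {V : Type*} [AddCommGroup V] [Module ℝ V] (k : ℕ) (v : V) :
    vs k • vs k • v = v := by
  rw [smul_smul, vs_mul_self, one_smul]

theorem vs_succ (k : ℕ) : vs (k + 1) = (-1) ^ (k + 1) * vs k := by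
  have h : (k + 1) * (k + 1 + 1) / 2 = k * (k + 1) / 2 + (k + 1) := by
    rw [show (k + 1) * (k + 1 + 1) = k * (k + 1) + (k + 1) * 2 by ring,
      Nat.add_mul_div_right _ _ two_pos]
  rw [vs, vs, h, pow_add]
  ring

theorem vs_eq (k : ℕ) : vs k = (-1) ^ (k + 1) * vs (k + 1) := by
  rw [vs_succ, ← mul_assoc, ← pow_add, ← two_mul, pow_mul]
  simp

end Signs

/-! ### The observables `L_∞(M, ω)` -/

section Observables

open DirectSum LInftyData
variable {E : Type*} [NormedAddCommGroup E] [NormedSpace ℝ E]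
variable {M : Type*} [TopologicalSpace M] [ChartedSpace E M] [IsManifold 𝓘(ℝ, E) ∞ M]
variable {n : ℕ} (P : PrePlectic E M n)

namespace PrePlectic

theorem obs_le (i : ℤ) : P.obs i ≤ homogForm E M (n - 1 + i) := by
  intro α h
  rw [obs] at h
  split_ifs at h with h1 h2
  · subst h1
    simpa using h.1
  · exact h
  · rw [(Submodule.mem_bot ℝ).1 h]; exact zero_mem _

theorem homogForm_le_obs {k : ℕ} (hk : 1 ≤ k) : homogForm E M (n - 1 - k) ≤ P.obs (-k) := by
  intro α h
  rw [obs]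
  split_ifs with h1 h2
  · omega
  · exact h
  · rw [Submodule.mem_bot]
    funext j
    exact h j (by omega)

variable [CompleteSpace E]

/-- The null elements of `L_∞(M, ω)`: the closed Hamiltonian forms, and everything outside
degree `0`. -/
def nullObs (a : P.obsData.ι) : Submodule ℝ (P.obsData.L a) where
  carrier := {γ : P.obs a | a = (0 : ℤ) → totD γ.1 = 0}
  zero_mem' := fun _ => map_zero totD
  add_mem' := fun {γ δ} hγ hδ ha => by
    refine (map_add totD γ.1 δ.1).trans ?_
    rw [hγ ha, hδ ha, add_zero]
  smul_mem' := fun c γ hγ ha => by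
    refine (map_smul totD c γ.1).trans ?_
    rw [hγ ha, smul_zero]

/-- The Hamiltonian vector field of a closed form inserts to zero in `ω`, so closed Hamiltonian
forms do not contribute to the higher brackets. -/
theorem isNull_nullObs : P.obsData.IsNull P.nullObs := by
  rintro k hk p γ ⟨i, hi⟩
  obtain ⟨k, rfl⟩ : ∃ l, k = l + 2 := ⟨k - 2, by omega⟩
  change P.obsBr (k + 2) hk (fun i => lof ℝ ℤ (fun i => P.obs i) (p i) (γ i)) = 0
  let δ (i : Fin (k + 2)) : P.ham := Submodule.inclusion P.obs_zero.le
    (DirectSum.component ℝ ℤ (fun i => P.obs i) 0 (lof ℝ ℤ (fun i => P.obs i) (p i) (γ i)))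
  have hδ : totD (δ i).1 = 0 := by
    have h (q : ℤ) (c : P.obs q) (hc : q = 0 → totD c.1 = 0) :
        totD (lof ℝ ℤ (fun i => P.obs i) q c 0).1 = 0 := by
      by_cases h : q = 0
      · subst h
        rw [lof_apply]
        exact hc rfl
      · rw [lof_eq_of, of_eq_of_ne _ _ _ (Ne.symm h)]
        exact map_zero _
    exact h _ (γ i) hi
  have hm : multiContr (k + 2) P.total (fun i => (P.hamVF (δ i) : VField E M)) = 0 := by
    rw [multiContr_congr (k + 2) P.total _
      (Function.update (fun i => (P.hamVF (δ i) : VField E M)) i 0) fun j => ?_,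
      MultilinearMap.map_update_zero]
    by_cases h : j = i
    · subst h
      rw [Function.update_self, map_zero, LinearMap.zero_apply, ← neg_eq_zero,
        ← P.isHamVF_hamVF (δ j), hδ]
    · rw [Function.update_of_ne h]
  refine (congrArg (lof ℝ ℤ (fun i => P.obs i) (2 - ((k + 2 : ℕ) : ℤ))) (Subtype.ext ?_)).trans
    (map_zero _)
  change vs (k + 2) • multiContr (k + 2) P.total (fun i => (P.hamVF (δ i) : VField E M)) = 0
  rw [hm, smul_zero]

theorem nullObs_eq_top (a : P.obsData.ι) (h : P.obsData.deg a < 0) : P.nullObs a = ⊤ :=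
  eq_top_iff.2 fun _ _ ha => absurd ha (Int.ne_of_lt h)

theorem toForm_lof (i : ℤ) (γ : P.obs i) :
    P.toForm (lof ℝ ℤ (fun i => P.obs i) i γ) = γ.1 :=
  DirectSum.coeLinearMap_lof P.obs i γ

/-- The spaces of `L_∞(M, ω)` consist of forms of different degrees. -/
theorem toForm_injective : Function.Injective P.toForm := by
  classical
  have key (y : ⨁ i : ℤ, P.obs i) (hy : DirectSum.coeLinearMap P.obs y = 0) : y = 0 := by
    refine DFinsupp.ext fun i => Subtype.ext (funext fun q => ?_)
    change (y i).1 q = 0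
    by_cases hq : (q : ℤ) = n - 1 + i
    · let ev : TotForm E M →ₗ[ℝ] Form E M q := LinearMap.proj q
      have h : ev (DirectSum.coeLinearMap P.obs y) = 0 := by rw [hy, map_zero]
      rw [← DirectSum.sum_support_of y, map_sum, map_sum, Finset.sum_eq_single i] at h
      · rw [← lof_eq_of ℝ, coeLinearMap_lof] at h
        exact h
      · intro j _ hj
        rw [← lof_eq_of ℝ, coeLinearMap_lof]
        exact P.obs_le j (y j).2 q (by omega)
      · intro hi
        rw [DFinsupp.notMem_support_iff.1 hi, map_zero, map_zero, map_zero]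
    · exact P.obs_le i (y i).2 q hq
  exact (injective_iff_map_eq_zero P.toForm).2 key

theorem toForm_mem_homogForm {d : ℤ} {y : P.obsData.Total} (hy : y ∈ P.obsData.homog d) :
    P.toForm y ∈ homogForm E M (n - 1 + d) := by
  refine P.obsData.homog_induction (p := fun y => P.toForm y ∈ homogForm E M (n - 1 + d)) ?_ ?_ ?_ hy
  · rw [map_zero]; exact zero_mem _
  · rintro (a : ℤ) (γ : P.obs a) (rfl : a = d)
    exact (congrArg (· ∈ homogForm E M (n - 1 + a)) (P.toForm_lof a γ)).mpr (P.obs_le a γ.2)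
  · intro y z hy hz
    rw [map_add]; exact add_mem hy hz

theorem toForm_diff {d : ℤ} (hd : d < 0) {y : P.obsData.Total} (hy : y ∈ P.obsData.homog d) :
    P.toForm (P.obsData.diff y) = totD (P.toForm y) := by
  refine P.obsData.homog_induction (p := fun y => P.toForm (P.obsData.diff y) =
    totD (P.toForm y)) ?_ ?_ ?_ hy
  · simp
  · rintro (a : ℤ) (γ : P.obs a) (rfl : a = d)
    have h : P.obsDiff (lof ℝ ℤ (fun i => P.obs i) a γ) =
        lof ℝ ℤ (fun i => P.obs i) (a + 1) ⟨totD γ.1, P.totD_mem_obs hd γ.2⟩ := by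
      rw [obsDiff, toModule_lof, dif_pos hd]
      rfl
    have h' : P.obsData.diff (lof ℝ ℤ (fun i => P.obs i) a γ) = _ :=
      (P.obsData.diff_apply _).trans h
    refine (congrArg P.toForm h').trans ?_
    exact (P.toForm_lof _ _).trans (congrArg totD (P.toForm_lof a γ)).symm
  · intro y z hy hz
    rw [map_add, map_add, hy, hz, map_add, map_add]

/-- For elements of degree `0`, the component of index `0` is the underlying form. -/
theorem apply_zero_toForm {y : P.obsData.Total} (hy : y ∈ P.obsData.homog 0) :
    (show P.obs 0 from y (0 : ℤ)).1 = P.toForm y := by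
  refine P.obsData.homog_induction (p := fun y => (show P.obs 0 from y (0 : ℤ)).1 = P.toForm y)
    ?_ ?_ ?_ hy
  · exact (map_zero _).symm
  · rintro (a : ℤ) (γ : P.obs a) (rfl : a = 0)
    refine Eq.trans ?_ (P.toForm_lof 0 γ).symm
    exact congrArg Subtype.val (lof_apply ℝ (M := fun i => P.obs i) (0 : ℤ) γ)
  · intro y z hy hz
    rw [map_add, ← hy, ← hz]
    rfl

end PrePlectic

end Observables

/-! ### Inner equivalence -/

section InnerEquivalence

open DirectSum LInftyData
variable {E : Type*} [NormedAddCommGroup E] [NormedSpace ℝ E]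
variable {M : Type*} [TopologicalSpace M] [ChartedSpace E M]
variable {𝔤 : Type*} [LieRing 𝔤] [LieAlgebra ℝ 𝔤]

/-- Rescaling a family by `ς(k)` turns `bracketSide` into the Chevalley-Eilenberg differential, up
to the factor `-ς(m - 1) = -(-1)^m ς(m)`. -/
theorem ceD_eq_bracketSide {η : ∀ k : ℕ, 𝔤 [⋀^Fin k]→ₗ[ℝ] TotForm E M}
    {g : ∀ k : ℕ, MultilinearMap ℝ (fun _ : Fin k => (lieData 𝔤).Total) (TotForm E M)}
    (h : ∀ (k : ℕ) (x : Fin k → 𝔤), 1 ≤ k → η k x = vs k • g k fun i => ofLie (x i))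
    {m : ℕ} (hm : 1 ≤ m) (x : Fin m → 𝔤) :
    ceD (fun k => η k) m x =
      -(((-1 : ℝ) ^ m * vs m) • bracketSide g m (fun _ => 0) fun i => ofLie (x i)) := by
  match m, hm with
  | 1, _ =>
    rw [bracketSide_lie_one, smul_zero, neg_zero]
    rfl
  | k + 2, _ =>
    rw [bracketSide_lie, ← vs_eq, ceD, Finset.smul_sum, ← Finset.sum_neg_distrib]
    refine Finset.sum_congr rfl fun i _ => ?_
    rw [Finset.smul_sum, ← Finset.sum_neg_distrib]
    refine Finset.sum_congr rfl fun j _ => ?_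
    rw [h _ _ (by omega), ← add_assoc, pow_succ]
    module

variable [IsManifold 𝓘(ℝ, E) ∞ M]

theorem totalD_eq_bracketSide {η : ∀ k : ℕ, 𝔤 [⋀^Fin k]→ₗ[ℝ] TotForm E M}
    {g : ∀ k : ℕ, MultilinearMap ℝ (fun _ : Fin k => (lieData 𝔤).Total) (TotForm E M)}
    (h : ∀ (k : ℕ) (x : Fin k → 𝔤), 1 ≤ k → η k x = vs k • g k fun i => ofLie (x i))
    {m : ℕ} (hm : 1 ≤ m) (x : Fin m → 𝔤) :
    totalD η m x = ((-1 : ℝ) ^ m * vs m) • (totD (g m fun i => ofLie (x i)) -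
      bracketSide g m (fun _ => 0) fun i => ofLie (x i)) := by
  rw [totalD, ceD_eq_bracketSide h hm, h m x hm, map_smul]
  module

variable [CompleteSpace E] {n : ℕ} {P : PrePlectic E M n}

/-- A solution `b` of `IsPrimitive f f'`, rescaled by `ς(k)`, is the same as a primitive of `φ' - φ`
for `d_tot`. -/
theorem isPrimitive_iff_totalD (f f' : LInftyHom (lieData 𝔤) P.obsData)
    {b : ∀ k : ℕ, MultilinearMap ℝ (fun _ : Fin k => (lieData 𝔤).Total) P.obsData.Total}
    (hb : ∀ (k : ℕ) x, 1 ≤ k → b k x ∈ P.obsData.homog (-k))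
    {η : ∀ k : ℕ, 𝔤 [⋀^Fin k]→ₗ[ℝ] TotForm E M}
    (h : ∀ (k : ℕ) (x : Fin k → 𝔤), 1 ≤ k → η k x = vs k • P.toForm (b k fun i => ofLie (x i))) :
    IsPrimitive f f' b ↔ ∀ (k : ℕ) (x : Fin k → 𝔤), 1 ≤ k →
      vs k • onLie f' k x - vs k • onLie f k x = totalD η k x := by
  have key (m : ℕ) (hm : 1 ≤ m) (x : Fin m → 𝔤) :
      (bracketSide b m (fun _ => 0) (fun i => ofLie (x i)) =
        P.obsData.diff (b m fun i => ofLie (x i)) + (-1 : ℝ) ^ m •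
          (f.comp m (fun i => ofLie (x i)) - f'.comp m fun i => ofLie (x i))) ↔
      vs m • onLie f' m x - vs m • onLie f m x = totalD η m x := by
    have hF (f : LInftyHom (lieData 𝔤) P.obsData) :
        P.toForm (f.comp m fun i => ofLie (x i)) = onLie f m x := rfl
    rw [totalD_eq_bracketSide (g := fun k => P.toForm.compMultilinearMap (b k)) h hm,
      bracketSide_comp, LinearMap.compMultilinearMap_apply, ← P.toForm_injective.eq_iff, map_add,
      map_smul, map_sub, hF, hF, P.toForm_diff (by omega) (hb m _ hm)]
    generalize P.toForm (bracketSide b m (fun _ => 0) fun i => ofLie (x i)) = u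
    generalize totD (P.toForm (b m fun i => ofLie (x i))) = w
    have h1 : ((-1 : ℝ) ^ m) * (-1) ^ m = 1 := by rw [← pow_add, ← two_mul, pow_mul]; simp
    have h2 := vs_mul_self m
    constructor
    · rintro rfl
      rw [sub_add_cancel_left, ← smul_neg, smul_smul, mul_right_comm, h1, one_mul, neg_sub, smul_sub]
    · intro e
      have e2 := congrArg (((-1 : ℝ) ^ m * vs m) • ·) e
      simp only [← smul_sub, smul_smul] at e2
      rw [mul_assoc, h2, mul_mul_mul_comm, h1, h2, one_mul, one_smul, mul_one] at e2
      rw [← neg_sub (onLie f' m x), smul_neg, e2]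
      abel
  constructor
  · intro hp m x hm
    exact (key m hm x).1 (hp m _ hm)
  · intro ht m x hm
    have := (key m hm fun i => toLie (x i)).2 (ht m _ hm)
    simpa only [ofLie_toLie] using this

theorem innerEquivalent_of_equivalent {f f' : LInftyHom (lieData 𝔤) P.obsData}
    (h : LInftyEquivalent f f') : InnerEquivalent f f' := by
  obtain ⟨H, hH⟩ := h
  let b (k : ℕ) : MultilinearMap ℝ (fun _ : Fin k => (lieData 𝔤).Total) P.obsData.Total :=
    P.obsData.integral.compMultilinearMap (H.comp k)
  have hp : IsPrimitive f f' b := isPrimitive_integral P.isNull_nullObs P.nullObs_eq_top H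
    (fun k hk => (hH k hk).1) fun k hk => (hH k hk).2
  have hb (k : ℕ) (x) (hk : 1 ≤ k) : b k x ∈ P.obsData.homog (-k) := by
    have := P.obsData.integral_mem_homog (H.degree_lie hk x)
    rwa [show (1 : ℤ) - k - 1 = -k by ring] at this
  let g (k : ℕ) : MultilinearMap ℝ (fun _ : Fin k => 𝔤) (TotForm E M) :=
    vs k • P.toForm.compMultilinearMap ((b k).compLinearMap fun _ => ofLie)
  have hg (k : ℕ) (x : Fin k → 𝔤) (i j : Fin k) (hij : (i : ℕ) + 1 = j) :
      g k (x ∘ Equiv.swap i j) = -g k x := by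
    have e : b k ((fun i => ofLie (x i)) ∘ Equiv.swap i j) = -b k fun i => ofLie (x i) :=
      (congrArg P.obsData.integral (H.skew_lie (fun i => ofLie (x i)) i j hij)).trans
        (map_neg P.obsData.integral _)
    change vs k • P.toForm (b k ((fun i => ofLie (x i)) ∘ Equiv.swap i j)) =
      -(vs k • P.toForm (b k fun i => ofLie (x i)))
    rw [e, map_neg, smul_neg]
  let η (k : ℕ) : 𝔤 [⋀^Fin k]→ₗ[ℝ] TotForm E M :=
    if k = 0 then 0 else { g k with
      map_eq_zero_of_eq' := fun x i j h hij => map_eq_zero_of_adjacent_swap (g k) (hg k) x i j h hij }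
  have hη (k : ℕ) (x : Fin k → 𝔤) (hk : 1 ≤ k) :
      η k x = vs k • P.toForm (b k fun i => ofLie (x i)) := by
    simp only [η, if_neg (show k ≠ 0 by omega)]
    rfl
  refine ⟨η, if_pos rfl, fun k x => ?_, (isPrimitive_iff_totalD f f' hb hη).1 hp⟩
  rcases Nat.eq_zero_or_pos k with rfl | hk
  · exact zero_mem _
  · rw [hη k x hk]
    exact Submodule.smul_mem _ _ (P.toForm_mem_homogForm (hb k _ hk))

theorem equivalent_of_innerEquivalent {f f' : LInftyHom (lieData 𝔤) P.obsData}
    (h : InnerEquivalent f f') : LInftyEquivalent f f' := by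
  obtain ⟨η, h0, hη, hd⟩ := h
  have hobs (k : ℕ) (x : Fin k → 𝔤) : η k x ∈ P.obs (-k) := by
    rcases Nat.eq_zero_or_pos k with rfl | hk
    · rw [h0]; exact zero_mem _
    · exact P.homogForm_le_obs hk (hη k x)
  let b (k : ℕ) : MultilinearMap ℝ (fun _ : Fin k => (lieData 𝔤).Total) P.obsData.Total :=
    (lof ℝ ℤ (fun i => P.obs i) (-k)).compMultilinearMap
      (vs k • ((η k).toMultilinearMap.codRestrict _ (hobs k)).compLinearMap fun _ => toLie)
  have hbη (k : ℕ) (x : Fin k → (lieData 𝔤).Total) :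
      P.toForm (b k x) = vs k • η k fun i => toLie (x i) := P.toForm_lof _ _
  have hb (k : ℕ) (x) (_ : 1 ≤ k) : b k x ∈ P.obsData.homog (-k) := fun a ha =>
    of_eq_of_ne (β := fun i : ℤ => P.obs i) _ _ _ ha
  refine equivalent_of_isPrimitive P.isNull_nullObs P.nullObs_eq_top (b := b) ?_ hb ?_
    ((isPrimitive_iff_totalD f f' hb (η := η) fun k x hk => ?_).2 hd)
  · rintro k x hk a (rfl : a = (0 : ℤ))
    have hm := sub_mem (f'.degree_lie hk x) (f.degree_lie hk x)
    obtain rfl | hk1 := eq_or_lt_of_le hk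
    · -- The equation for `η` in arity `1` says that `f'₁(x) - f₁(x)` is exact.
      have e := hd 1 (fun i => toLie (x i)) le_rfl
      have e1 (f : LInftyHom (lieData 𝔤) P.obsData) :
          onLie f 1 (fun i => toLie (x i)) = P.toForm (f.comp 1 x) :=
        congrArg (fun y => P.toForm (f.comp 1 y)) (funext fun i => ofLie_toLie (x i))
      have e2 : totalD η 1 (fun i => toLie (x i)) =
          (-1 : ℝ) ^ 1 • totD (η 1 fun i => toLie (x i)) := zero_add _
      have e3 := congrArg (fun u => totD (vs 1 • u)) (e.trans e2)
      simp only [← smul_sub, vs_smul_vs_smul, e1, ← map_sub] at e3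
      rw [map_smul, map_smul, totD_totD, smul_zero, smul_zero] at e3
      refine (congrArg totD (P.apply_zero_toForm ?_)).trans e3
      simpa using hm
    · have h : (show P.obs 0 from (f'.comp k x - f.comp k x) (0 : ℤ)) = 0 := hm (0 : ℤ) (by
        change (0 : ℤ) ≠ _
        omega)
      exact (congrArg (fun γ : P.obs 0 => totD γ.1) h).trans (map_zero _)
  · intro k x i j hij
    refine P.toForm_injective ?_
    rw [map_neg, hbη, hbη, ← smul_neg]
    congr 1
    exact (η k).map_swap (fun i => toLie (x i)) (by simp [Fin.ext_iff]; omega)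
  · rw [hbη, vs_smul_vs_smul]
    simp only [toLie_ofLie]

end InnerEquivalence

end MomentMaps

end

theorem mainTheorem8
    {E : Type*} [NormedAddCommGroup E] [NormedSpace ℝ E] [FiniteDimensional ℝ E]
    {M : Type*} [TopologicalSpace M] [ChartedSpace E M] [IsManifold 𝓘(ℝ, E) ∞ M]
    [T2Space M] [SecondCountableTopology M]
    {EG : Type*} [NormedAddCommGroup EG] [NormedSpace ℝ EG] [FiniteDimensional ℝ EG]
    {G : Type*} [TopologicalSpace G] [ChartedSpace EG G] [Group G] [LieGroup 𝓘(ℝ, EG) ∞ G]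
    [MulAction G M] [ContMDiffSMul 𝓘(ℝ, EG) 𝓘(ℝ, E) ∞ G M]
    (n : ℕ) (hn : 1 ≤ n) (P : MomentMaps.PrePlectic E M n)
    (hG : MomentMaps.IsInvariant G P.form)
    (f f' : MomentMaps.HomotopyMomentMap EG G P) :
    MomentMaps.InnerEquivalent f.toHom f'.toHom ↔
      MomentMaps.LInftyEquivalent f.toHom f'.toHom := by
  have : CompleteSpace E := FiniteDimensional.complete ℝ E
  exact ⟨MomentMaps.equivalent_of_innerEquivalent, MomentMaps.innerEquivalent_of_equivalent⟩
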